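/- A $k$-graph $H=(V,E)$ ($k$-uniform hypergraph) has density $d(H)=|E|/\binom{|V|}{k}$, and $H[S]$ denotes the subgraph induced by $S\subseteq V$. Consider sequences $\mathcal H=\{H_n\}_{n\ge 1}$ of finite $k$-graphs $H_n=(V_n,E_n)$ such that $|V_n|\to\infty$ and $\lim_{n\to\infty} d(H_n)$ exists. Such a sequence is called $\rho$-quasirandom if for every $\varepsilon>0$ there is $n_0$ such that for all $n>n_0$, every $W\subseteq V_n$ with $|W|\ge\varepsilon|V_n|$ satisfies $d(H_n[W])\in[\rho(1-\varepsilon),\rho(1+\varepsilon)]$. The upper density of $\mathcal H$ is $$\overline d(\mathcal H)=\lim_{s\to\infty}\ \max_{n}\ \max_{S\in\binom{V_n}{s}} d(H_n[S]).$$ **Theorem.** For each integer $k\ge 4$ there exist $\rho>0$ and a $\rho$-quasirandom sequence of $k$-graphs whose upper density equals $\dfrac{k!}{k^k-k}$. -/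

import Mathlib

open Filter Topology

/-- A `k`-graph (`k`-uniform hypergraph) on the vertex set `V`: a set of edges, each of which is a
set of exactly `k` vertices. -/
structure KGraph (k : ℕ) (V : Type) where
  edges : Finset (Finset V)
  uniform : ∀ e ∈ edges, e.card = k

namespace KGraph

variable {k : ℕ} {V : Type}

open Classical in
/-- The subgraph `H[S]` induced by a vertex set `S`: its vertex set is `S` and its edges are the
edges of `H` all of whose vertices lie in `S`. -/
noncomputable def induce (H : KGraph k V) (S : Finset V) : KGraph k {v // v ∈ S} where
  edges := Finset.univ.filter fun e => e.map (Function.Embedding.subtype _) ∈ H.edges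
  uniform := by
    intro e he
    have h := H.uniform _ (Finset.mem_filter.mp he).2
    simpa using h

/-- The density `|E| / (|V| choose k)` of a `k`-graph (it is `0` if there are fewer than `k`
vertices). -/
noncomputable def density [Fintype V] (H : KGraph k V) : ℝ :=
  (H.edges.card : ℝ) / ((Fintype.card V).choose k : ℝ)

end KGraph

/-- A sequence of `k`-graphs on finite vertex sets whose sizes tend to infinity, and whose densities
converge. -/
structure KGraphSequence (k : ℕ) where
  V : ℕ → Type
  [fintypeV : ∀ n, Fintype (V n)]
  graph : ∀ n, KGraph k (V n)
  card_tendsto : Tendsto (fun n => Fintype.card (V n)) atTop atTop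
  density_converges : ∃ d : ℝ, Tendsto (fun n => (graph n).density) atTop (𝓝 d)

namespace KGraphSequence

attribute [instance] KGraphSequence.fintypeV

variable {k : ℕ}

/-- `ρ`-quasirandomness: for each `ε > 0`, for all large `n`, all vertex sets `W` with
`|W| ≥ ε |V n|` induce subgraphs of density in `[ρ (1 - ε), ρ (1 + ε)]`. -/
def IsQuasirandom (H : KGraphSequence k) (ρ : ℝ) : Prop :=
  ∀ ε : ℝ, 0 < ε → ∃ n₀ : ℕ, ∀ n : ℕ, n₀ < n → ∀ W : Finset (H.V n),
    ε * (Fintype.card (H.V n) : ℝ) ≤ (W.card : ℝ) →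
      ((H.graph n).induce W).density ∈ Set.Icc (ρ * (1 - ε)) (ρ * (1 + ε))

/-- The upper density of the sequence exists and equals `d`: the maximum `m s` of the density of the
induced subgraph on `S`, over all `n` and all `s`-sets `S` of vertices of the `n`-th graph, is
attained for each `s`, and `m s → d` as `s → ∞`. -/
def HasUpperDensity (H : KGraphSequence k) (d : ℝ) : Prop :=
  ∃ m : ℕ → ℝ,
    (∀ s : ℕ, IsGreatest
      {x : ℝ | ∃ (n : ℕ) (S : Finset (H.V n)), S.card = s ∧
        x = ((H.graph n).induce S).density} (m s)) ∧
    Tendsto m atTop (𝓝 d)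

end KGraphSequence

/-!
Fix `k ≥ 4`. If every ordered pair of vertices carries one of `k` labels, call a `k`-tuple
consistent if its `i`-th vertex sees all its other vertices with the label `i`. The sets of entries
of consistent tuples form a `k`-graph (`labelGraph`), in which an edge determines the order of its
vertices (`card_edges_induce_labelGraph`).

The labelling `evalLabel` has as vertices the pairs of a function `Fin n → Fin k` and a point of
`Fin n`, and `u` sees `v` with the value of the function of `u` at the point of `v`. This labelling
is random-like: in the count of consistent tuples in a set, the `k * (k - 1)` conditions on the
labels can be replaced one at a time by a factor `1 / k`, with a negligible error by the
Cauchy–Schwarz inequality (`abs_sum_mul_eval_le`, `abs_tupleCount_evalLabel_sub_le`). So the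
sequence of its hypergraphs is quasirandom with the positive density `evalDensity k`. It is also
universal: each labelling of a finite set is induced by some `evalLabel`
(`exists_le_tupleCount_evalLabel`), in particular the labelling `wordLabel` of the iterated blow-up
of an edge. Since a suitable deletion of vertices does not lower the density, this gives `s`-sets of
density at least `k! / (k ^ k - k) - o(1)` for all `s`.

The matching upper bound `tupleCount_le` holds for an arbitrary labelling. Take a probability vector
`w` on the vertices that maximizes the weight `p` of the consistent tuples, and suppose that
`p > 1 / (k ^ k - k)`. By optimality every vertex `x` has degree at least `k * p * w x`
(`IsOptimalWeight.mul_le_sum_incidentMass`), and the degree is at most a sum of `(k - 1)`-st powers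
of the weights of the labels at `x`, so that one label `c x` dominates at each vertex
(`IsOptimalWeight.exists_dominant`). Partition the vertices by their dominant labels into `k` parts
of weights `s i`. The degree bound also forces the dominant label of a vertex to be well spread over
the other parts (`IsOptimalWeight.spread_dominant`). Therefore the edges that are neither
transversal to the parts, with each vertex in the role of its dominant label, nor inside a part, are
outweighed by the transversals that are not consistent (`mul_tupleMass_irregular_le`,
`le_mul_tupleMass_lost`). What remains is `p ≤ ∏ i, s i + p * ∑ i, s i ^ k`, the last sum by the
maximality of `p` inside the parts. The inequality of the arithmetic and the geometric mean, applied
to the cyclic shifts of the monomials of `(∑ i, s i) ^ k`, bounds `(k ^ k - k) * ∏ i, s i` by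
`1 - ∑ i, s i ^ k` (`prod_le_one_sub_sum_pow`), and hence `p ≤ 1 / (k ^ k - k)`
(`IsOptimalWeight.le`).
-/

/-! ### Means and numerical estimates -/

/-- The inequality between the arithmetic and the geometric mean, without roots. -/
lemma prod_le_sum_div_card_pow {ι : Type*} (s : Finset ι) (f : ι → ℝ) (hf : ∀ i ∈ s, 0 ≤ f i) :
    ∏ i ∈ s, f i ≤ ((∑ i ∈ s, f i) / s.card) ^ s.card := by
  rcases s.eq_empty_or_nonempty with rfl | hs
  · simp
  have hc : 0 < (s.card : ℝ) := by exact_mod_cast hs.card_pos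
  have h := Real.geom_mean_le_arith_mean s (fun _ => 1) f (fun _ _ => zero_le_one)
    (by simpa using hs.card_pos) hf
  simp only [Real.rpow_one, Finset.sum_const, nsmul_eq_mul, mul_one, one_mul] at h
  have hp : 0 ≤ ∏ i ∈ s, f i := Finset.prod_nonneg hf
  calc ∏ i ∈ s, f i = ((∏ i ∈ s, f i) ^ ((s.card : ℝ)⁻¹)) ^ s.card := by
        rw [← Real.rpow_natCast, ← Real.rpow_mul hp, inv_mul_cancel₀ hc.ne', Real.rpow_one]
    _ ≤ _ := pow_le_pow_left₀ (Real.rpow_nonneg hp _) h _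

lemma prod_le_div_card_pow {ι : Type*} (s : Finset ι) (f : ι → ℝ) (hf : ∀ i ∈ s, 0 ≤ f i)
    {m : ℕ} (hm : s.card = m) {a : ℝ} (ha : ∑ i ∈ s, f i ≤ a) :
    ∏ i ∈ s, f i ≤ (a / m) ^ m := by
  refine (prod_le_sum_div_card_pow s f hf).trans ?_
  rw [hm]
  have := Finset.sum_nonneg hf
  gcongr

lemma mul_one_sub_div_pow_le (n : ℕ) (hn : 0 < n) {u : ℝ} (h0 : 0 ≤ u) (h1 : u ≤ 1) :
    u * ((1 - u) / n) ^ n ≤ (1 / ((n : ℝ) + 1)) ^ (n + 1) := by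
  have hn' : (0 : ℝ) < n := by exact_mod_cast hn
  have h := prod_le_div_card_pow Finset.univ
    (Fin.cons u (fun _ => (1 - u) / n) : Fin (n + 1) → ℝ) (by
      intro i _
      refine Fin.cases ?_ (fun j => ?_) i
      · simpa using h0
      · simpa using div_nonneg (sub_nonneg.2 h1) hn'.le) (m := n + 1) (by simp) (a := 1) (by
      rw [Fin.sum_univ_succ]
      simp only [Fin.cons_zero, Fin.cons_succ, Finset.sum_const, Finset.card_univ, Fintype.card_fin,
        nsmul_eq_mul]
      rw [mul_div_cancel₀ _ hn'.ne']
      linarith)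
  rw [Fin.prod_univ_succ] at h
  simpa [div_pow] using h

lemma add_two_pow_le_exp_mul (n : ℕ) :
    ((n : ℝ) + 2) ^ (n + 1) ≤ Real.exp 1 * ((n : ℝ) + 1) ^ (n + 1) := by
  have h := Real.add_one_le_exp (1 / ((n : ℝ) + 1))
  have h2 : ((n : ℝ) + 2) ≤ Real.exp (1 / ((n : ℝ) + 1)) * ((n : ℝ) + 1) := by
    calc ((n : ℝ) + 2) = (1 / ((n : ℝ) + 1) + 1) * ((n : ℝ) + 1) := by field_simp; ring
      _ ≤ _ := by gcongr
  calc ((n : ℝ) + 2) ^ (n + 1) ≤ (Real.exp (1 / ((n : ℝ) + 1)) * ((n : ℝ) + 1)) ^ (n + 1) := by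
        gcongr
    _ = _ := by
        rw [mul_pow, ← Real.exp_nat_mul]
        congr 2
        push_cast
        field_simp

/-- The numbers that drive the stability argument for the `(n + 2)`-uniform problem. In the
application `b` bounds the weight `β` of the minority labels at a vertex, and `τ * β` is a lower
bound for the weight that the vertex sees with its majority label in any other part. The number
`1 / ((n + 2) ^ (n + 1) - 1)` is the normalized degree of a vertex in the iterated blow-up of an
edge. `exists_dominant` yields the majority label, `small_end` and `large_end` contradict the degree
bound if the majority label is badly spread, and `spread` makes the lost transversals outweigh the
irregular edges. -/
structure IsStabilityPair (n : ℕ) (b τ : ℝ) : Prop where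
  b_pos : 0 < b
  b_le : b ≤ 1 / 2
  τ_pos : 0 < τ
  exists_dominant : ∀ a : Fin (n + 2) → ℝ, (∀ i, 0 ≤ a i) → ∑ i, a i = 1 →
    1 / (((n : ℝ) + 2) ^ (n + 1) - 1) ≤ ∑ i, (a i / ((n : ℝ) + 1)) ^ (n + 1) → ∃ i, 1 - b ≤ a i
  small_end : ∀ β y : ℝ, 0 ≤ y → y ≤ τ * β → β ≤ b →
    y * ((1 - β - y) / n) ^ n + (β / ((n : ℝ) + 1)) ^ (n + 1) < 1 / (((n : ℝ) + 2) ^ (n + 1) - 1)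
  large_end : ∀ β : ℝ, 0 ≤ β → β ≤ b →
    (1 - b) * (b / n) ^ n + (β / ((n : ℝ) + 1)) ^ (n + 1) < 1 / (((n : ℝ) + 2) ^ (n + 1) - 1)
  spread : ((n : ℝ) + 2) / n * (1 / (n : ℝ)) ^ n ≤ τ ^ n

/-- The constants of `isStabilityPair_of_three_le` do not serve here: `spread` needs `1 / √2 ≤ τ`,
and `large_end` needs a smaller `b` than `1 / 2`. -/
lemma isStabilityPair_two : IsStabilityPair 2 (13 / 50) (5 / 7) where
  b_pos := by norm_num
  b_le := by norm_num
  τ_pos := by norm_num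
  exists_dominant := by
    intro a ha hs h
    obtain ⟨m, -, hm⟩ := Finset.exists_max_image Finset.univ a ⟨0, Finset.mem_univ _⟩
    refine ⟨m, ?_⟩
    set M := a m with hM
    have hM0 : 0 ≤ M := ha m
    have hsum : ∑ i, a i ^ 3 ≥ 3 / 7 := by
      norm_num [div_pow, ← Finset.sum_div] at h
      linarith
    have hM1 : M ≤ 1 := by
      rw [← hs]; exact Finset.single_le_sum (fun i _ => ha i) (Finset.mem_univ m)
    have h1 : 3 / 7 ≤ M ^ 2 := by
      calc 3 / 7 ≤ ∑ i, a i ^ 3 := hsum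
        _ ≤ ∑ i, M ^ 2 * a i := by
          refine Finset.sum_le_sum fun i _ => ?_
          have h3 := hm i (Finset.mem_univ _)
          calc a i ^ 3 = a i ^ 2 * a i := by ring
            _ ≤ M ^ 2 * a i := by
              have := ha i
              gcongr
        _ = M ^ 2 := by rw [← Finset.mul_sum, hs, mul_one]
    have h2 : 3 / 7 ≤ M ^ 3 + (1 - M) ^ 3 := by
      have hr : ∑ i ∈ Finset.univ.erase m, a i = 1 - M := by
        rw [← hs, ← Finset.add_sum_erase _ _ (Finset.mem_univ m)]; ring
      calc 3 / 7 ≤ ∑ i, a i ^ 3 := hsum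
        _ = M ^ 3 + ∑ i ∈ Finset.univ.erase m, a i ^ 3 := by
          rw [← Finset.add_sum_erase _ _ (Finset.mem_univ m)]
        _ ≤ M ^ 3 + ∑ i ∈ Finset.univ.erase m, (1 - M) ^ 2 * a i := by
          gcongr with i hi
          have h3 : a i ≤ 1 - M := by
            rw [← hr]; exact Finset.single_le_sum (fun i _ => ha i) hi
          calc a i ^ 3 = a i ^ 2 * a i := by ring
            _ ≤ (1 - M) ^ 2 * a i := by
              have := ha i
              gcongr
        _ = M ^ 3 + (1 - M) ^ 3 := by rw [← Finset.mul_sum, hr]; ring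
    by_contra hcon
    push Not at hcon
    nlinarith
  small_end := by
    intro β y hy0 hy hb
    have hβ : 0 ≤ β := by linarith
    have h1 : y * (1 - β - y) ^ 2 ≤ (5 / 7 * β) * (1 - β - 5 / 7 * β) ^ 2 := by
      have hd : 0 ≤ 5 / 7 * β - y := by linarith
      have : (5 / 7 * β) * (1 - β - 5 / 7 * β) ^ 2 - y * (1 - β - y) ^ 2
          = (5 / 7 * β - y) * ((1 - β) ^ 2 - 2 * (1 - β) * (5 / 7 * β + y)
            + ((5 / 7 * β) ^ 2 + 5 / 7 * β * y + y ^ 2)) := by ring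
      have h3 : 0 ≤ (1 - β) ^ 2 - 2 * (1 - β) * (5 / 7 * β + y)
            + ((5 / 7 * β) ^ 2 + 5 / 7 * β * y + y ^ 2) := by
        have h4 : 0 ≤ 1 - β - 3 * (5 / 7 * β) := by linarith
        have h5 : 0 ≤ 1 - β + 3 * (5 / 7 * β) - 2 * (5 / 7 * β + y) := by linarith
        have h6 : 0 ≤ 4 * (5 / 7 * β) - y := by linarith
        nlinarith [mul_nonneg h4 h5, mul_nonneg h6 hd]
      nlinarith [mul_nonneg hd h3]
    have h2 : (5 / 7 * β) * (1 - β - 5 / 7 * β) ^ 2 / 4 + β ^ 3 / 27 < 1 / 63 := by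
      nlinarith [mul_nonneg hβ (sq_nonneg (β - 41 / 200)), mul_nonneg (sub_nonneg.2 hb)
        (sq_nonneg (β - 41 / 200)), sq_nonneg (β - 41 / 200)]
    norm_num
    nlinarith
  large_end := by
    intro β h0 hb
    have : β ^ 3 ≤ (13 / 50) ^ 3 := by gcongr
    norm_num [div_pow] at this ⊢
    linarith
  spread := by norm_num

lemma isStabilityPair_of_three_le {n : ℕ} (hn : 3 ≤ n) : IsStabilityPair n (1 / n) (1 / 2) := by
  have hn3 : (3 : ℝ) ≤ n := by exact_mod_cast hn
  have he := Real.exp_one_lt_d9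
  have hE := add_two_pow_le_exp_mul n
  have hp1 : 0 < ((n : ℝ) + 1) ^ (n + 1) := by positivity
  have hp2 : 1 < ((n : ℝ) + 2) ^ (n + 1) := one_lt_pow₀ (by linarith) (by omega)
  have hc : 1 / ((n : ℝ) + 2) ^ (n + 1) < 1 / (((n : ℝ) + 2) ^ (n + 1) - 1) :=
    one_div_lt_one_div_of_lt (by linarith) (by linarith)
  have hb3 : 1 / (n : ℝ) ≤ 1 / 3 := one_div_le_one_div_of_le (by norm_num) hn3
  have hdiv : 1 / ((n : ℝ) + 1) ^ (n + 1) ≤ 2.7183 * (1 / ((n : ℝ) + 2) ^ (n + 1)) := by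
    rw [mul_one_div, div_le_div_iff₀ hp1 (by linarith)]
    nlinarith
  -- the contribution of the minority labels is at most `1 / 81` of the trivial bound
  have hβ : ∀ β : ℝ, 0 ≤ β → β ≤ 1 / n →
      (β / ((n : ℝ) + 1)) ^ (n + 1) ≤ 1 / 81 * (1 / ((n : ℝ) + 1) ^ (n + 1)) := by
    intro β h0 h1
    rw [div_pow, div_eq_mul_one_div]
    gcongr
    calc β ^ (n + 1) ≤ (1 / 3 : ℝ) ^ (n + 1) := by gcongr; linarith
      _ ≤ (1 / 3 : ℝ) ^ 4 := pow_le_pow_of_le_one (by norm_num) (by norm_num) (by omega)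
      _ = 1 / 81 := by norm_num
  refine ⟨by positivity, by linarith, by norm_num, ?_, ?_, ?_, ?_⟩
  · intro a ha hs h
    obtain ⟨m, -, hm⟩ := Finset.exists_max_image Finset.univ a ⟨0, Finset.mem_univ _⟩
    refine ⟨m, ?_⟩
    have h1 : ∑ i, (a i / ((n : ℝ) + 1)) ^ (n + 1) ≤ a m ^ n / ((n : ℝ) + 1) ^ (n + 1) := by
      calc ∑ i, (a i / ((n : ℝ) + 1)) ^ (n + 1)
          ≤ ∑ i, a m ^ n * a i / ((n : ℝ) + 1) ^ (n + 1) := by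
            refine Finset.sum_le_sum fun i _ => ?_
            rw [div_pow, pow_succ]
            have := ha i
            have := hm i (Finset.mem_univ _)
            gcongr
        _ = _ := by rw [← Finset.sum_div, ← Finset.mul_sum, hs, mul_one]
    have h2 : Real.exp (-1) < a m ^ n := by
      have h3 := hc.trans_le (h.trans h1)
      rw [div_lt_div_iff₀ (by linarith) hp1] at h3
      rw [Real.exp_neg, inv_lt_iff_one_lt_mul₀ (Real.exp_pos 1)]
      have hm0 : 0 ≤ a m ^ n := pow_nonneg (ha m) n
      have := mul_le_mul_of_nonneg_left hE hm0
      by_contra hcon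
      push Not at hcon
      nlinarith
    by_contra hcon
    push Not at hcon
    have h4 := Real.one_sub_div_pow_le_exp_neg (n := n) (t := 1) (by linarith)
    have h5 : a m ^ n ≤ (1 - 1 / (n : ℝ)) ^ n := pow_le_pow_left₀ (ha m) hcon.le n
    linarith
  · intro β y hy0 hy hb
    have hβ0 : 0 ≤ β := by linarith
    have h1 := mul_one_sub_div_pow_le n (by omega) (u := 3 * y) (by linarith) (by linarith)
    have h2 : y * ((1 - β - y) / n) ^ n ≤ y * ((1 - 3 * y) / n) ^ n := by
      have h4 : (1 - β - y) / n ≤ (1 - 3 * y) / n := by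
        apply div_le_div_of_nonneg_right <;> linarith
      have h5 : 0 ≤ (1 - β - y) / n := div_nonneg (by linarith) (by linarith)
      gcongr
    have h3 := hβ β hβ0 hb
    rw [one_div_pow] at h1
    have : 0 < 1 / ((n : ℝ) + 2) ^ (n + 1) := by positivity
    linarith
  · intro β h0 hb
    have h3 := hβ β h0 hb
    have h4 : (1 - 1 / (n : ℝ)) * (1 / n / (n : ℝ)) ^ n ≤
        9 / 10 * (1 / ((n : ℝ) + 2) ^ (n + 1)) := by
      have h5 : (1 / n / (n : ℝ)) ≤ 5 / 9 / ((n : ℝ) + 2) := by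
        rw [div_div, div_le_div_iff₀ (by positivity) (by positivity)]
        nlinarith
      have h6 : (5 / 9 : ℝ) ^ n * ((n : ℝ) + 2) ≤ 9 / 10 := by
        clear * - hn
        induction n, hn using Nat.le_induction with
        | base => norm_num
        | succ m hm ih =>
          have : (3 : ℝ) ≤ m := by exact_mod_cast hm
          refine le_trans ?_ ih
          rw [pow_succ, mul_assoc]
          gcongr
          push_cast
          linarith
      calc (1 - 1 / (n : ℝ)) * (1 / n / (n : ℝ)) ^ n
          ≤ 1 * (5 / 9 / ((n : ℝ) + 2)) ^ n := by
            gcongr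
            linarith [show 0 < 1 / (n : ℝ) by positivity]
        _ = (5 / 9 : ℝ) ^ n * ((n : ℝ) + 2) * (1 / ((n : ℝ) + 2) ^ (n + 1)) := by
            rw [div_pow, pow_succ]; field_simp
        _ ≤ _ := by gcongr
    have : 0 < 1 / ((n : ℝ) + 2) ^ (n + 1) := by positivity
    nlinarith
  · rw [one_div_pow, one_div_pow, mul_one_div, div_le_div_iff₀ (by positivity) (by positivity),
      one_mul]
    have h1 : ((n : ℝ) + 2) / n ≤ (3 / 2 : ℝ) ^ n := by
      calc ((n : ℝ) + 2) / n ≤ 3 / 2 * (3 / 2) := by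
            rw [div_le_iff₀ (by linarith)]; linarith
        _ = (3 / 2) ^ 2 := by norm_num
        _ ≤ (3 / 2 : ℝ) ^ n := pow_le_pow_right₀ (by norm_num) (by omega)
    calc ((n : ℝ) + 2) / n * 2 ^ n ≤ (3 / 2 : ℝ) ^ n * 2 ^ n := by gcongr
      _ = 3 ^ n := by rw [← mul_pow]; norm_num
      _ ≤ (n : ℝ) ^ n := by gcongr

lemma exists_isStabilityPair {n : ℕ} (hn : 2 ≤ n) : ∃ b τ, IsStabilityPair n b τ := by
  rcases hn.eq_or_lt with rfl | h
  · exact ⟨_, _, isStabilityPair_two⟩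
  · exact ⟨_, _, isStabilityPair_of_three_le h⟩

/-- Every monomial of `(∑ x i) ^ k` other than a `k`-th power is at least the product of all `x i`
in the mean. The average is taken over the cyclic shifts of the exponent vector. -/
lemma prod_le_one_sub_sum_pow {k : ℕ} [NeZero k] (x : Fin k → ℝ) (hx : ∀ i, 0 ≤ x i)
    (hs : ∑ i, x i = 1) :
    ((k : ℝ) ^ k - k) * ∏ i, x i ≤ 1 - ∑ i, x i ^ k := by
  classical
  set S : Finset (Fin k → Fin k) := Finset.univ.filter fun f => ¬ ∃ c, f = fun _ => c with hS
  have hk : (0 : ℝ) < k := by exact_mod_cast NeZero.pos k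
  have hconst : Finset.univ.filter (fun f : Fin k → Fin k => ∃ c, f = fun _ => c)
      = Finset.univ.image (fun c : Fin k => fun _ : Fin k => c) := by
    ext f; simp [eq_comm]
  have hinj : Function.Injective (fun c : Fin k => fun _ : Fin k => c) :=
    fun a b h => congrFun h 0
  have h1 : ∑ f ∈ S, ∏ i, x (f i) = 1 - ∑ i, x i ^ k := by
    have h2 : ∑ f : Fin k → Fin k, ∏ i, x (f i) = 1 := by
      have h3 := Fintype.prod_sum (fun (_ : Fin k) (j : Fin k) => x j)
      rw [← h3]
      simp [hs]
    rw [← h2, ← Finset.sum_filter_add_sum_filter_not Finset.univ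
      (fun f : Fin k → Fin k => ∃ c, f = fun _ => c), hconst, Finset.sum_image hinj.injOn]
    simp [hS]
  have hcard : (S.card : ℝ) = (k : ℝ) ^ k - k := by
    have h3 := Finset.card_filter_add_card_filter_not (s := (Finset.univ : Finset (Fin k → Fin k)))
      (fun f : Fin k → Fin k => ∃ c, f = fun _ => c)
    rw [hconst, Finset.card_image_of_injective _ hinj] at h3
    simp only [Finset.card_univ, Fintype.card_fin, Fintype.card_fun] at h3
    rw [eq_sub_iff_add_eq, add_comm]
    exact_mod_cast h3
  have hshift : ∀ s : Fin k, ∑ f ∈ S, ∏ i, x (f i) = ∑ f ∈ S, ∏ i, x (f i + s) := by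
    intro s
    symm
    refine Finset.sum_bij' (fun f _ i => f i + s) (fun f _ i => f i - s) ?_ ?_ ?_ ?_ ?_
    · intro f hf
      simp only [hS, Finset.mem_filter, Finset.mem_univ, true_and, not_exists] at hf ⊢
      intro c hc
      refine hf (c - s) (funext fun i => ?_)
      rw [eq_sub_iff_add_eq]; exact congrFun hc i
    · intro f hf
      simp only [hS, Finset.mem_filter, Finset.mem_univ, true_and, not_exists] at hf ⊢
      intro c hc
      refine hf (c + s) (funext fun i => ?_)
      rw [← sub_eq_iff_eq_add]; exact congrFun hc i
    · intro f _; simp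
    · intro f _; simp
    · intro f _; rfl
  have hmean : ∀ f : Fin k → Fin k, k * ∏ i, x i ≤ ∑ s : Fin k, ∏ i, x (f i + s) := by
    intro f
    have h4 := prod_le_sum_div_card_pow Finset.univ (fun s : Fin k => ∏ i, x (f i + s))
      (fun s _ => Finset.prod_nonneg fun i _ => hx _)
    rw [Finset.prod_comm] at h4
    have h5 : ∀ i, ∏ s, x (f i + s) = ∏ s, x s := fun i =>
      Fintype.prod_equiv (Equiv.addLeft (f i)) _ _ fun _ => rfl
    simp only [h5, Finset.prod_const, Finset.card_univ, Fintype.card_fin] at h4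
    have h6 := le_of_pow_le_pow_left₀ (NeZero.ne k) (div_nonneg (Finset.sum_nonneg fun s _ =>
      Finset.prod_nonneg fun i _ => hx _) hk.le) h4
    rw [le_div_iff₀ hk] at h6
    linarith
  have h7 : (k : ℝ) * ∑ f ∈ S, ∏ i, x (f i) = ∑ f ∈ S, ∑ s : Fin k, ∏ i, x (f i + s) := by
    rw [Finset.sum_comm, ← Finset.sum_congr rfl fun s _ => hshift s]
    simp
  have h8 : ∑ f ∈ S, k * ∏ i, x i ≤ ∑ f ∈ S, ∑ s : Fin k, ∏ i, x (f i + s) :=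
    Finset.sum_le_sum fun f _ => hmean f
  rw [Finset.sum_const, nsmul_eq_mul, hcard, ← h7, h1] at h8
  have h9 : (k : ℝ) * (((k : ℝ) ^ k - k) * ∏ i, x i) ≤ k * (1 - ∑ i, x i ^ k) := by linarith
  exact le_of_mul_le_mul_left h9 hk

/-! ### Labellings and weighted counts of consistent tuples -/

section Labelling

variable {V : Type*} {k : ℕ}

/-- A labelling `ℓ` gives each ordered pair of vertices one of `k` labels. A `k`-tuple is consistent
if its `i`-th vertex sees all the other vertices of the tuple with label `i`. The edges of the
hypergraphs studied here are the sets of entries of consistent tuples. -/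
def IsConsistent (ℓ : V → V → Fin k) (z : Fin k → V) : Prop :=
  ∀ i j, i ≠ j → ℓ (z i) (z j) = i

variable [Fintype V]

open Classical in
/-- The weight of the set of vertices that satisfy `S`. -/
noncomputable def vertexMass (w : V → ℝ) (S : V → Prop) : ℝ := ∑ u with S u, w u

open Classical in
/-- The weight of the set of tuples that satisfy `S`, in the product weight. -/
noncomputable def tupleMass (w : V → ℝ) (S : (Fin k → V) → Prop) : ℝ := ∑ z with S z, ∏ i, w (z i)

variable {w : V → ℝ}

lemma vertexMass_eq (w : V → ℝ) (S : V → Prop) [DecidablePred S] :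
    vertexMass w S = ∑ u with S u, w u := by
  unfold vertexMass
  congr!

lemma tupleMass_eq (w : V → ℝ) (S : (Fin k → V) → Prop) [DecidablePred S] :
    tupleMass w S = ∑ z with S z, ∏ i, w (z i) := by
  unfold tupleMass
  congr!

lemma tupleMass_eq_zero (w : V → ℝ) {S : (Fin k → V) → Prop} (h : ∀ z, ¬ S z) :
    tupleMass w S = 0 := by
  classical
  rw [tupleMass_eq, Finset.filter_false_of_mem fun z _ => h z, Finset.sum_empty]

lemma vertexMass_nonneg (hw : ∀ u, 0 ≤ w u) (S : V → Prop) : 0 ≤ vertexMass w S :=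
  Finset.sum_nonneg fun u _ => hw u

lemma vertexMass_mono (hw : ∀ u, 0 ≤ w u) {S T : V → Prop} (h : ∀ u, S u → T u) :
    vertexMass w S ≤ vertexMass w T := by
  classical
  exact Finset.sum_le_sum_of_subset_of_nonneg (Finset.monotone_filter_right _ fun u _ => h u)
    fun u _ _ => hw u

lemma vertexMass_eq_self (w : V → ℝ) (x : V) : vertexMass w (fun u => u = x) = w x := by
  classical
  have h : (Finset.univ.filter fun u => u = x) = {x} := by ext; simp
  unfold vertexMass
  convert! Finset.sum_singleton w x

lemma vertexMass_true (w : V → ℝ) : vertexMass w (fun _ => True) = ∑ u, w u := by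
  simp [vertexMass]

lemma sum_vertexMass_fiber {ι : Type*} [Fintype ι] (w : V → ℝ) (S : V → Prop) (f : V → ι) :
    ∑ i, vertexMass w (fun u => S u ∧ f u = i) = vertexMass w S := by
  classical
  unfold vertexMass
  rw [← Finset.sum_fiberwise _ f]
  refine Finset.sum_congr rfl fun i _ => Finset.sum_congr ?_ fun _ _ => rfl
  ext
  simp

lemma vertexMass_and_add_and_not (w : V → ℝ) (S T : V → Prop) :
    vertexMass w (fun u => S u ∧ T u) + vertexMass w (fun u => S u ∧ ¬ T u) = vertexMass w S := by
  classical
  unfold vertexMass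
  rw [← Finset.sum_filter_add_sum_filter_not (Finset.univ.filter fun u => S u) T]
  simp only [Finset.filter_filter]

lemma tupleMass_nonneg (hw : ∀ u, 0 ≤ w u) (S : (Fin k → V) → Prop) : 0 ≤ tupleMass w S :=
  Finset.sum_nonneg fun _ _ => Finset.prod_nonneg fun _ _ => hw _

lemma tupleMass_mono (hw : ∀ u, 0 ≤ w u) {S T : (Fin k → V) → Prop} (h : ∀ z, S z → T z) :
    tupleMass w S ≤ tupleMass w T := by
  classical
  exact Finset.sum_le_sum_of_subset_of_nonneg (Finset.monotone_filter_right _ fun u _ => h u)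
    fun _ _ _ => Finset.prod_nonneg fun _ _ => hw _

lemma sum_tupleMass_fiber {ι : Type*} [Fintype ι] (w : V → ℝ) (S : (Fin k → V) → Prop)
    (f : (Fin k → V) → ι) :
    ∑ i, tupleMass w (fun z => S z ∧ f z = i) = tupleMass w S := by
  classical
  unfold tupleMass
  rw [← Finset.sum_fiberwise _ f]
  refine Finset.sum_congr rfl fun i _ => Finset.sum_congr ?_ fun _ _ => rfl
  ext
  simp

lemma tupleMass_and_add_and_not (w : V → ℝ) (S T : (Fin k → V) → Prop) :
    tupleMass w (fun z => S z ∧ T z) + tupleMass w (fun z => S z ∧ ¬ T z) = tupleMass w S := by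
  classical
  unfold tupleMass
  rw [← Finset.sum_filter_add_sum_filter_not (Finset.univ.filter fun z => S z) T]
  simp only [Finset.filter_filter]

lemma tupleMass_forall (w : V → ℝ) (T : Fin k → V → Prop) :
    tupleMass w (fun z => ∀ i, T i (z i)) = ∏ i, vertexMass w (T i) := by
  classical
  unfold tupleMass vertexMass
  rw [Finset.prod_univ_sum]
  refine Finset.sum_congr ?_ fun _ _ => rfl
  ext z
  simp [Fintype.mem_piFinset]

lemma tupleMass_eq_and_forall (w : V → ℝ) (i : Fin k) (x : V) (T : Fin k → V → Prop) :
    tupleMass w (fun z => z i = x ∧ ∀ m, m ≠ i → T m (z m)) =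
      w x * ∏ m ∈ Finset.univ.erase i, vertexMass w (T m) := by
  classical
  have h : (fun z : Fin k → V => z i = x ∧ ∀ m, m ≠ i → T m (z m)) =
      fun z => ∀ m, (if m = i then fun u => u = x else T m) (z m) := by
    funext z
    refine propext ⟨?_, ?_⟩
    · rintro ⟨h1, h2⟩ m
      by_cases hm : m = i
      · subst hm; simpa using h1
      · simpa [hm] using h2 m hm
    · intro h
      refine ⟨by simpa using h i, fun m hm => by simpa [hm] using h m⟩
  rw [h, tupleMass_forall, ← Finset.mul_prod_erase _ _ (Finset.mem_univ i), if_pos rfl,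
    vertexMass_eq_self]
  congr 1
  refine Finset.prod_congr rfl fun m hm => ?_
  rw [if_neg (Finset.ne_of_mem_erase hm)]

lemma tupleMass_eq_eq_and_forall (w : V → ℝ) {i j : Fin k} (hij : j ≠ i) (x y : V)
    (T : Fin k → V → Prop) :
    tupleMass w (fun z => z i = x ∧ z j = y ∧ ∀ m, m ≠ i → m ≠ j → T m (z m)) =
      w x * w y * ∏ m ∈ (Finset.univ.erase i).erase j, vertexMass w (T m) := by
  classical
  have h : (fun z : Fin k → V => z i = x ∧ z j = y ∧ ∀ m, m ≠ i → m ≠ j → T m (z m)) =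
      fun z => z i = x ∧ ∀ m, m ≠ i → (if m = j then fun u => u = y else T m) (z m) := by
    funext z
    refine propext (and_congr_right fun _ => ⟨?_, ?_⟩)
    · rintro ⟨h1, h2⟩ m hm
      by_cases hm' : m = j
      · subst hm'; simpa using h1
      · simpa [hm'] using h2 m hm hm'
    · intro h
      exact ⟨by simpa using h j hij, fun m hm hm' => by simpa [hm'] using h m hm⟩
  rw [h, tupleMass_eq_and_forall, ← Finset.mul_prod_erase (Finset.univ.erase i) _
    (Finset.mem_erase.2 ⟨hij, Finset.mem_univ j⟩), if_pos rfl, vertexMass_eq_self, mul_assoc]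
  congr 2
  refine Finset.prod_congr rfl fun m hm => ?_
  rw [if_neg (Finset.ne_of_mem_erase hm)]

variable (ℓ : V → V → Fin k)

/-- The weight of the vertices that `x` sees with label `i`. -/
noncomputable def outMass (w : V → ℝ) (x : V) (i : Fin k) : ℝ := vertexMass w fun u => ℓ x u = i

/-- The weight of the vertices that `x` sees with label `i` and that see `x` with label `j`. -/
noncomputable def pairMass (w : V → ℝ) (x : V) (i j : Fin k) : ℝ :=
  vertexMass w fun u => ℓ x u = i ∧ ℓ u x = j

lemma sum_pairMass (w : V → ℝ) (x : V) (i : Fin k) :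
    ∑ j, pairMass ℓ w x i j = outMass ℓ w x i :=
  sum_vertexMass_fiber w _ fun u => ℓ u x

lemma sum_outMass (w : V → ℝ) (x : V) : ∑ i, outMass ℓ w x i = ∑ u, w u := by
  have h := sum_vertexMass_fiber w (fun _ => True) fun u => ℓ x u
  simpa [vertexMass_true, outMass] using h

lemma pairMass_nonneg (hw : ∀ u, 0 ≤ w u) (x : V) (i j : Fin k) : 0 ≤ pairMass ℓ w x i j :=
  vertexMass_nonneg hw _

lemma outMass_nonneg (hw : ∀ u, 0 ≤ w u) (x : V) (i : Fin k) : 0 ≤ outMass ℓ w x i :=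
  vertexMass_nonneg hw _

lemma prod_pairMass_le (hw : ∀ u, 0 ≤ w u) (s : Finset (Fin k)) {m : ℕ} (hm : s.card = m) (x : V)
    (i : Fin k) : ∏ j ∈ s, pairMass ℓ w x i j ≤ (outMass ℓ w x i / m) ^ m := by
  refine prod_le_div_card_pow s _ (fun j _ => pairMass_nonneg ℓ hw x i j) hm ?_
  rw [← sum_pairMass]
  exact Finset.sum_le_sum_of_subset_of_nonneg (Finset.subset_univ s)
    fun j _ _ => pairMass_nonneg ℓ hw x i j

/-- The weight of the consistent tuples in which `x` is the `i`-th vertex. -/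
noncomputable def incidentMass (w : V → ℝ) (x : V) (i : Fin k) : ℝ :=
  tupleMass w fun z => IsConsistent ℓ z ∧ z i = x

lemma incidentMass_le (hw : ∀ u, 0 ≤ w u) (x : V) (i : Fin k) :
    incidentMass ℓ w x i ≤ w x * ∏ j ∈ Finset.univ.erase i, pairMass ℓ w x i j := by
  unfold pairMass
  rw [← tupleMass_eq_and_forall w i x fun j u => ℓ x u = i ∧ ℓ u x = j]
  refine tupleMass_mono hw ?_
  rintro z ⟨hz, rfl⟩
  exact ⟨rfl, fun m hm => ⟨hz i m hm.symm, hz m i hm⟩⟩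

lemma codegreeMass_le (hw : ∀ u, 0 ≤ w u) (x y : V) {i j : Fin k} (hij : j ≠ i) :
    tupleMass w (fun z => IsConsistent ℓ z ∧ z i = x ∧ z j = y) ≤
      w x * w y * ∏ m ∈ (Finset.univ.erase i).erase j, pairMass ℓ w x i m := by
  unfold pairMass
  rw [← tupleMass_eq_eq_and_forall w hij x y fun j u => ℓ x u = i ∧ ℓ u x = j]
  refine tupleMass_mono hw ?_
  rintro z ⟨hz, rfl, rfl⟩
  exact ⟨rfl, rfl, fun m hm hm' => ⟨hz i m hm.symm, hz m i hm⟩⟩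

end Labelling

section Optimal

variable {V : Type*} [Fintype V] {n : ℕ} (ℓ : V → V → Fin (n + 2)) (w : V → ℝ)

/-- The probability vector `w` maximizes the weight of the consistent tuples, and the maximum
is `p`. Maximality is stated in homogeneous form. -/
structure IsOptimalWeight (p : ℝ) : Prop where
  nonneg : ∀ u, 0 ≤ w u
  sum_eq_one : ∑ u, w u = 1
  mass_eq : tupleMass w (IsConsistent ℓ) = p
  mass_le : ∀ w' : V → ℝ, (∀ u, 0 ≤ w' u) →
    tupleMass w' (IsConsistent ℓ) ≤ p * (∑ u, w' u) ^ (n + 2)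

variable {ℓ w} {p : ℝ}

lemma IsOptimalWeight.p_nonneg (h : IsOptimalWeight ℓ w p) : 0 ≤ p :=
  h.mass_eq ▸ tupleMass_nonneg h.nonneg _

/-- At a maximum all vertices of positive weight have the same degree. Only the lower bound is
needed, and it comes from lowering the weight of a single vertex. -/
lemma IsOptimalWeight.mul_le_sum_incidentMass (h : IsOptimalWeight ℓ w p) (x : V) :
    ((n : ℝ) + 2) * p * w x ≤ ∑ i, incidentMass ℓ w x i := by
  classical
  set D := ∑ i, incidentMass ℓ w x i with hD
  have hp := h.p_nonneg
  have hwx := h.nonneg x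
  have hwx1 : w x ≤ 1 := by
    rw [← h.sum_eq_one]; exact Finset.single_le_sum (fun u _ => h.nonneg u) (Finset.mem_univ x)
  have hDeq : D = ∑ z with IsConsistent ℓ z,
      ((Finset.univ.filter fun i => z i = x).card : ℝ) * ∏ i, w (z i) := by
    have h1 : ∀ i, incidentMass ℓ w x i =
        ∑ z with IsConsistent ℓ z, if z i = x then ∏ j, w (z j) else 0 := by
      intro i
      rw [← Finset.sum_filter, Finset.filter_filter]
      refine Finset.sum_congr ?_ fun _ _ => rfl
      ext
      simp
    rw [hD, Finset.sum_congr rfl fun i _ => h1 i, Finset.sum_comm]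
    refine Finset.sum_congr rfl fun z _ => ?_
    rw [← Finset.sum_filter, Finset.sum_const, nsmul_eq_mul]
  -- perturb the weight of `x` by the factor `1 - t`
  have key : ∀ t : ℝ, 0 ≤ t → t ≤ 1 → p - t * D ≤ p * (1 - t * w x) ^ (n + 2) := by
    intro t ht0 ht1
    have h1 := h.mass_le (fun u => w u * if u = x then 1 - t else 1) (fun u => by
      refine mul_nonneg (h.nonneg u) ?_
      split_ifs <;> linarith)
    have h2 : ∑ u, w u * (if u = x then 1 - t else 1) = 1 - t * w x := by
      have : ∀ u, w u * (if u = x then 1 - t else 1) = w u - if u = x then t * w x else 0 := by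
        intro u; split_ifs with hu
        · rw [hu]; ring
        · ring
      simp only [this, Finset.sum_sub_distrib, h.sum_eq_one, Finset.sum_ite_eq', Finset.mem_univ,
        if_true]
    rw [h2] at h1
    refine le_trans ?_ h1
    rw [← h.mass_eq, hDeq, Finset.mul_sum]
    unfold tupleMass
    rw [← Finset.sum_sub_distrib]
    refine Finset.sum_le_sum fun z _ => ?_
    rw [Finset.prod_mul_distrib, Finset.prod_ite, Finset.prod_const, Finset.prod_const_one, mul_one]
    have h3 := one_add_mul_le_pow (a := -t) (by linarith)
      (Finset.univ.filter fun i => z i = x).card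
    have h4 : 0 ≤ ∏ i, w (z i) := Finset.prod_nonneg fun i _ => h.nonneg _
    have h5 := mul_le_mul_of_nonneg_left h3 h4
    rw [← sub_eq_add_neg] at h5
    linarith
  have hpow : ∀ s : ℝ, 0 ≤ s → s ≤ 1 →
      (1 - s) ^ (n + 2) ≤ 1 - ((n : ℝ) + 2) * s + (((n : ℝ) + 2) * s) ^ 2 := by
    intro s hs0 hs1
    have h1 := one_add_mul_le_pow (a := s) (by linarith) (n + 2)
    push_cast at h1
    have h2 : (1 - s) ^ (n + 2) * (1 + s) ^ (n + 2) ≤ 1 := by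
      rw [← mul_pow]
      exact pow_le_one₀ (by nlinarith) (by nlinarith)
    have h3 : 0 ≤ (1 - s) ^ (n + 2) := pow_nonneg (by linarith) _
    set a := ((n : ℝ) + 2) * s with ha
    have ha0 : 0 ≤ a := by positivity
    have h4 : (1 - s) ^ (n + 2) * (1 + a) ≤ 1 := (mul_le_mul_of_nonneg_left h1 h3).trans h2
    have h5 : (1 - s) ^ (n + 2) * (1 + a) ≤ (1 - a + a ^ 2) * (1 + a) := by
      nlinarith [pow_nonneg ha0 3]
    exact le_of_mul_le_mul_right h5 (by linarith)
  by_contra hcon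
  push Not at hcon
  set δ := ((n : ℝ) + 2) * p * w x - D with hδ
  have hδ0 : 0 < δ := by linarith
  set C := p * (((n : ℝ) + 2) * w x) ^ 2 with hC
  have hC0 : 0 ≤ C := by positivity
  have hle : ∀ t : ℝ, 0 < t → t ≤ 1 → δ ≤ C * t := by
    intro t ht0 ht1
    have h1 := key t ht0.le ht1
    have h2 := mul_le_mul_of_nonneg_left (hpow (t * w x) (by positivity) (by nlinarith)) hp
    have h3 : t * δ ≤ t * (C * t) := by rw [hδ, hC]; nlinarith
    exact le_of_mul_le_mul_left h3 ht0
  have h1 := hle (δ / (δ + C)) (by positivity) (by rw [div_le_one (by positivity)]; linarith)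
  rw [mul_div_assoc', le_div_iff₀ (by positivity)] at h1
  nlinarith

lemma sum_div_pow_le {a : Fin (n + 2) → ℝ} (ha : ∀ i, 0 ≤ a i) (s : Finset (Fin (n + 2))) :
    ∑ i ∈ s, (a i / ((n : ℝ) + 1)) ^ (n + 1) ≤ ((∑ i ∈ s, a i) / ((n : ℝ) + 1)) ^ (n + 1) := by
  have hn : (0 : ℝ) < (n : ℝ) + 1 := by positivity
  rw [Finset.sum_div]
  induction s using Finset.cons_induction with
  | empty => simp
  | cons i s hi ih =>
    rw [Finset.sum_cons, Finset.sum_cons]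
    refine (add_le_add_right ih _).trans ?_
    exact pow_add_pow_le (div_nonneg (ha i) hn.le)
      (Finset.sum_nonneg fun j _ => div_nonneg (ha j) hn.le) (by omega)

lemma incidentMass_le_pow (hw : ∀ u, 0 ≤ w u) (x : V) (i : Fin (n + 2)) :
    incidentMass ℓ w x i ≤ w x * (outMass ℓ w x i / ((n : ℝ) + 1)) ^ (n + 1) := by
  refine (incidentMass_le ℓ hw x i).trans ?_
  have h := prod_pairMass_le ℓ hw (Finset.univ.erase i) (m := n + 1)
    (by simp [Finset.card_erase_of_mem]) x i
  push_cast at h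
  exact mul_le_mul_of_nonneg_left h (hw x)

/-- If the optimum is at least that of the iterated blow-up of an edge, then every vertex of
positive weight sees almost all of the weight outside its own part with a single label. -/
lemma IsOptimalWeight.exists_dominant (h : IsOptimalWeight ℓ w p) {b τ : ℝ}
    (hb : IsStabilityPair n b τ) (hp : 1 / (((n : ℝ) + 2) ^ (n + 1) - 1) ≤ ((n : ℝ) + 2) * p) :
    ∃ c : V → Fin (n + 2), ∀ x, 0 < w x → 1 - b ≤ outMass ℓ w x (c x) := by
  have : ∀ x, ∃ i, 0 < w x → 1 - b ≤ outMass ℓ w x i := by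
    intro x
    by_cases hx : 0 < w x
    · obtain ⟨i, hi⟩ := hb.exists_dominant (outMass ℓ w x) (outMass_nonneg ℓ h.nonneg x)
        (by rw [sum_outMass, h.sum_eq_one]) (by
          refine hp.trans ?_
          have h1 := (h.mul_le_sum_incidentMass x).trans
            (Finset.sum_le_sum fun i _ => incidentMass_le_pow h.nonneg x i)
          rw [← Finset.mul_sum, mul_comm (w x)] at h1
          exact le_of_mul_le_mul_right h1 hx)
      exact ⟨i, fun _ => hi⟩
    · exact ⟨0, fun h => absurd h hx⟩
  choose c hc using this
  exact ⟨c, hc⟩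

end Optimal

/-! ### The dominant label of a vertex is spread over all parts -/

section Spread

variable {n : ℕ}

/-- The purely numerical part of `IsOptimalWeight.spread_dominant`. The bound on `X` is convex in
`d`, so that it suffices to look at the two ends of the range of `d`. -/
lemma IsStabilityPair.mul_le {b τ : ℝ} (hb : IsStabilityPair n b τ) (hn : 2 ≤ n)
    {X d y β P : ℝ} (hX : 1 / (((n : ℝ) + 2) ^ (n + 1) - 1) ≤ X + (β / ((n : ℝ) + 1)) ^ (n + 1))
    (hβ0 : 0 ≤ β) (hβ : β ≤ b) (hy0 : 0 ≤ y) (hyd : y ≤ d) (hd : d ≤ 1 - β) (hP0 : 0 ≤ P)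
    (hP : P ≤ ((1 - β - d) / n) ^ n) (h1 : X ≤ d * P)
    (h2 : X ≤ y * P + (d - y) * (b / n) ^ n) : τ * β ≤ y := by
  by_contra hcon
  push Not at hcon
  have hA := hb.small_end β y hy0 hcon.le hβ
  have hB := hb.large_end β hβ0 hβ
  have hA' : y * ((1 - β - y) / n) ^ n < X := by linarith
  have hB' : (1 - b) * (b / n) ^ n < X := by linarith
  have hn0 : (0 : ℝ) < n := by exact_mod_cast (by omega : 0 < n)
  have hb0 := hb.b_pos
  have hb2 := hb.b_le
  set κ := (b / n) ^ n with hκ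
  have hκ0 : 0 ≤ κ := by positivity
  set r := 1 - β - d with hr
  have hr0 : 0 ≤ r := by linarith
  rcases le_or_gt r b with hrb | hrb
  · have h3 : (r / n) ^ n ≤ r / b * κ := by
      have h4 : (r / b) ^ n ≤ r / b :=
        pow_le_of_le_one (by positivity) (by rw [div_le_one hb0]; exact hrb) (by omega)
      calc (r / n) ^ n = (r / b) ^ n * κ := by
            rw [hκ, ← mul_pow]; congr 1; field_simp
        _ ≤ _ := by gcongr
    have h5 : X ≤ (1 - r) * (r / b * κ) := by
      calc X ≤ d * P := h1
        _ ≤ (1 - r) * (r / b * κ) := by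
          apply mul_le_mul (by linarith) (hP.trans h3) hP0 (by linarith)
    have h6 : (1 - r) * (r / b * κ) ≤ (1 - b) * κ := by
      have : (1 - r) * (r / b) ≤ 1 - b := by
        rw [mul_div_assoc', div_le_iff₀ hb0]
        nlinarith
      calc (1 - r) * (r / b * κ) = (1 - r) * (r / b) * κ := by ring
        _ ≤ _ := by gcongr
    linarith
  · have hconv : ConvexOn ℝ (Set.Ici 0)
        fun r : ℝ => y / (n : ℝ) ^ n * r ^ n + (1 - β - y - r) * κ := by
      refine ⟨convex_Ici 0, fun u hu v hv s t hs ht hst => ?_⟩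
      have h3 := (convexOn_pow (𝕜 := ℝ) n).2 hu hv hs ht hst
      simp only [smul_eq_mul] at h3 ⊢
      have h4 : 0 ≤ y / (n : ℝ) ^ n := by positivity
      have h5 := mul_le_mul_of_nonneg_left h3 h4
      have h6 : t = 1 - s := by linarith
      subst h6
      linarith
    have h3 : X ≤ y / (n : ℝ) ^ n * r ^ n + (1 - β - y - r) * κ := by
      have h4 : y * P ≤ y * (r / n) ^ n := by gcongr
      rw [div_pow] at h4
      have h5 : y * (r ^ n / (n : ℝ) ^ n) = y / (n : ℝ) ^ n * r ^ n := by ring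
      have h6 : d - y = 1 - β - y - r := by rw [hr]; ring
      rw [h5] at h4
      rw [← h6]
      linarith
    have h4 := hconv.le_max_of_mem_Icc (x := b) (y := 1 - β - y) (z := r) (by simpa using hb0.le)
      (by simp only [Set.mem_Ici]; linarith) ⟨hrb.le, by linarith⟩
    rcases le_max_iff.1 (h3.trans h4) with h5 | h5
    · have h6 : y / (n : ℝ) ^ n * b ^ n = y * κ := by rw [hκ, div_pow]; ring
      rw [h6] at h5
      nlinarith
    · have h6 : y / (n : ℝ) ^ n * (1 - β - y) ^ n = y * ((1 - β - y) / n) ^ n := by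
        rw [div_pow]; ring
      rw [h6] at h5
      linarith

variable {V : Type*} [Fintype V] {ℓ : V → V → Fin (n + 2)} {w : V → ℝ} {p : ℝ}

lemma card_erase_erase {i j : Fin (n + 2)} (h : j ≠ i) :
    ((Finset.univ.erase i).erase j).card = n := by
  rw [Finset.card_erase_of_mem (Finset.mem_erase.2 ⟨h, Finset.mem_univ j⟩),
    Finset.card_erase_of_mem (Finset.mem_univ i)]
  simp

lemma prod_pairMass_erase_erase_le (hw : ∀ u, 0 ≤ w u) (x : V) {i j : Fin (n + 2)} (h : j ≠ i) :
    ∏ m ∈ (Finset.univ.erase i).erase j, pairMass ℓ w x i m ≤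
      ((outMass ℓ w x i - pairMass ℓ w x i j) / n) ^ n := by
  refine prod_le_div_card_pow _ _ (fun m _ => pairMass_nonneg ℓ hw x i m) (card_erase_erase h) ?_
  rw [← sum_pairMass, ← Finset.add_sum_erase _ _ (Finset.mem_univ j), add_sub_cancel_left,
    Finset.erase_right_comm]
  exact Finset.sum_le_sum_of_subset_of_nonneg (Finset.erase_subset _ _)
    fun m _ _ => pairMass_nonneg ℓ hw x i m

lemma outMass_le_one_sub (h : IsOptimalWeight ℓ w p) (x : V) {i j : Fin (n + 2)} (hij : i ≠ j) :
    outMass ℓ w x i ≤ 1 - outMass ℓ w x j := by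
  have h1 : outMass ℓ w x i + outMass ℓ w x j ≤ ∑ m, outMass ℓ w x m := by
    rw [← Finset.sum_pair hij]
    exact Finset.sum_le_sum_of_subset_of_nonneg (Finset.subset_univ _)
      fun m _ _ => outMass_nonneg ℓ h.nonneg x m
  rw [sum_outMass, h.sum_eq_one] at h1
  linarith

/-- Apart from the edges in which `x` has label `a`, the edges at `x` have small weight. -/
lemma IsOptimalWeight.mul_le_incidentMass (h : IsOptimalWeight ℓ w p) (x : V) (a : Fin (n + 2)) :
    w x * (((n : ℝ) + 2) * p - ((1 - outMass ℓ w x a) / ((n : ℝ) + 1)) ^ (n + 1)) ≤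
      incidentMass ℓ w x a := by
  have h1 := h.mul_le_sum_incidentMass x
  rw [← Finset.add_sum_erase _ _ (Finset.mem_univ a)] at h1
  have h2 : ∑ i ∈ Finset.univ.erase a, incidentMass ℓ w x i ≤
      w x * ((1 - outMass ℓ w x a) / ((n : ℝ) + 1)) ^ (n + 1) := by
    refine (Finset.sum_le_sum fun i _ => incidentMass_le_pow h.nonneg x i).trans ?_
    rw [← Finset.mul_sum]
    refine mul_le_mul_of_nonneg_left ?_ (h.nonneg x)
    refine (sum_div_pow_le (outMass_nonneg ℓ h.nonneg x) _).trans (le_of_eq ?_)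
    rw [← h.sum_eq_one, ← sum_outMass ℓ w x, ← Finset.add_sum_erase _ _ (Finset.mem_univ a),
      add_sub_cancel_left]
  linarith

/-- Split the edges in which `x` has label `a` by whether their `i`-th vertex has dominant label
`i`. -/
lemma IsOptimalWeight.incidentMass_le_add (h : IsOptimalWeight ℓ w p) {b : ℝ}
    {c : V → Fin (n + 2)} (hc : ∀ x, 0 < w x → 1 - b ≤ outMass ℓ w x (c x)) (x : V)
    {a i : Fin (n + 2)} (hia : i ≠ a) :
    incidentMass ℓ w x a ≤ w x *
      (vertexMass w (fun u => (ℓ x u = a ∧ ℓ u x = i) ∧ c u = i) *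
          ∏ m ∈ (Finset.univ.erase a).erase i, pairMass ℓ w x a m +
        (pairMass ℓ w x a i - vertexMass w (fun u => (ℓ x u = a ∧ ℓ u x = i) ∧ c u = i)) *
          (b / n) ^ n) := by
  classical
  have hw := h.nonneg
  rw [incidentMass, ← tupleMass_and_add_and_not w _ (fun z => c (z i) = i), mul_add]
  refine add_le_add ?_ ?_
  · have h1 := tupleMass_eq_and_forall w a x (fun m u =>
      (ℓ x u = a ∧ ℓ u x = m) ∧ (m = i → c u = i))
    rw [← Finset.mul_prod_erase (Finset.univ.erase a) _
      (Finset.mem_erase.2 ⟨hia, Finset.mem_univ i⟩)] at h1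
    have h2 : ∏ m ∈ (Finset.univ.erase a).erase i,
        vertexMass w (fun u => (ℓ x u = a ∧ ℓ u x = m) ∧ (m = i → c u = i)) =
        ∏ m ∈ (Finset.univ.erase a).erase i, pairMass ℓ w x a m := by
      refine Finset.prod_congr rfl fun m hm => ?_
      have := Finset.ne_of_mem_erase hm
      simp [pairMass, this]
    simp only [h2, forall_const] at h1
    rw [← h1]
    refine tupleMass_mono hw ?_
    rintro z ⟨⟨hz, rfl⟩, hz'⟩
    refine ⟨rfl, fun m hm => ⟨⟨hz a m hm.symm, hz m a hm⟩, ?_⟩⟩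
    rintro rfl
    exact hz'
  · have h1 : pairMass ℓ w x a i - vertexMass w (fun u => (ℓ x u = a ∧ ℓ u x = i) ∧ c u = i) =
        vertexMass w (fun u => (ℓ x u = a ∧ ℓ u x = i) ∧ ¬ c u = i) := by
      rw [pairMass, ← vertexMass_and_add_and_not w _ (fun u => c u = i)]
      ring
    rw [h1, ← sum_tupleMass_fiber w _ fun z => z i, vertexMass, Finset.sum_mul, Finset.mul_sum,
      Finset.sum_filter]
    refine Finset.sum_le_sum fun u _ => ?_
    split_ifs with hu
    · have h2 : tupleMass w (fun z => ((IsConsistent ℓ z ∧ z a = x) ∧ ¬ c (z i) = i) ∧ z i = u) ≤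
          w u * w x * (b / n) ^ n := by
        refine (tupleMass_mono hw (T := fun z => IsConsistent ℓ z ∧ z i = u ∧ z a = x)
          fun z hz => ⟨hz.1.1.1, hz.2, hz.1.1.2⟩).trans ?_
        refine (codegreeMass_le ℓ hw u x hia.symm).trans ?_
        rcases (hw u).eq_or_lt with h0 | h0
        · rw [← h0]; simp
        have h3 := outMass_le_one_sub h u (Ne.symm hu.2)
        have h4 := hc u h0
        have := hw x
        gcongr
        refine (prod_pairMass_le ℓ hw _ (card_erase_erase hia.symm) u i).trans ?_
        have := outMass_nonneg ℓ hw u i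
        gcongr
        linarith
      linarith
    · refine le_of_eq ?_
      refine tupleMass_eq_zero w ?_
      rintro z ⟨⟨⟨hz, rfl⟩, hz'⟩, rfl⟩
      exact hu ⟨⟨hz a i hia.symm, hz i a hia⟩, hz'⟩

/-- In every part other than its own, a vertex sees a substantial weight with its dominant label,
compared to the total weight that it sees with other labels. -/
lemma IsOptimalWeight.spread_dominant (h : IsOptimalWeight ℓ w p) {b τ : ℝ}
    (hb : IsStabilityPair n b τ) (hn : 2 ≤ n)
    (hp : 1 / (((n : ℝ) + 2) ^ (n + 1) - 1) ≤ ((n : ℝ) + 2) * p)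
    {c : V → Fin (n + 2)} (hc : ∀ x, 0 < w x → 1 - b ≤ outMass ℓ w x (c x)) {x : V} (hx : 0 < w x)
    {i : Fin (n + 2)} (hi : i ≠ c x) :
    τ * (1 - outMass ℓ w x (c x)) ≤ vertexMass w (fun u => c u = i ∧ ℓ x u = c x) := by
  have hw := h.nonneg
  have h1 := h.mul_le_incidentMass x (c x)
  have h2 := h1.trans (h.incidentMass_le_add hc x hi)
  have h3 := h1.trans (incidentMass_le ℓ hw x (c x))
  rw [← Finset.mul_prod_erase _ _ (Finset.mem_erase.2 ⟨hi, Finset.mem_univ i⟩)] at h3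
  have h4 := prod_pairMass_erase_erase_le (ℓ := ℓ) hw x hi
  have hle : pairMass ℓ w x (c x) i ≤ outMass ℓ w x (c x) :=
    vertexMass_mono hw fun u hu => hu.1
  have hout : outMass ℓ w x (c x) ≤ 1 := by
    have := vertexMass_mono hw (S := fun u => ℓ x u = c x) (T := fun _ => True) (by simp)
    rwa [vertexMass_true, h.sum_eq_one] at this
  refine (hb.mul_le hn (β := 1 - outMass ℓ w x (c x)) (d := pairMass ℓ w x (c x) i)
    (X := ((n : ℝ) + 2) * p - ((1 - outMass ℓ w x (c x)) / ((n : ℝ) + 1)) ^ (n + 1))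
    (P := ∏ m ∈ (Finset.univ.erase (c x)).erase i, pairMass ℓ w x (c x) m)
    (by linarith) (by linarith) (by linarith [hc x hx]) (vertexMass_nonneg hw _)
    (vertexMass_mono hw fun u hu => hu.1) (by linarith)
    (Finset.prod_nonneg fun m _ => pairMass_nonneg ℓ hw x _ m) (by simpa using h4)
    (le_of_mul_le_mul_left h3 hx) (le_of_mul_le_mul_left h2 hx)).trans ?_
  exact vertexMass_mono hw fun u hu => ⟨hu.2, hu.1.1⟩

end Spread

/-! ### Edges that respect the partition, and the upper bound -/

section UpperBound

variable {n : ℕ}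

/-- If `f` is neither the identity nor constant, then there are many pairs `(i, j)` such that `i` is
moved and `j` lies in another fibre of `f` than `i`. -/
lemma le_card_pairs_of_not_id_of_not_const (f : Fin (n + 2) → Fin (n + 2))
    (hid : ¬ ∀ i, f i = i) (hconst : ¬ ∃ l, ∀ i, f i = l) :
    n ≤ (Finset.univ.filter fun q : Fin (n + 2) × Fin (n + 2) =>
      f q.1 ≠ q.1 ∧ f q.2 ≠ f q.1).card := by
  classical
  by_cases hinj : Function.Injective f
  · push Not at hid
    obtain ⟨i, hi⟩ := hid
    have h1 : ({i} ×ˢ Finset.univ.erase i : Finset (Fin (n + 2) × Fin (n + 2))) ⊆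
        Finset.univ.filter fun q => f q.1 ≠ q.1 ∧ f q.2 ≠ f q.1 := by
      rintro ⟨a, j⟩ h
      simp only [Finset.mem_product, Finset.mem_singleton, Finset.mem_erase, Finset.mem_univ,
        and_true] at h
      obtain ⟨rfl, hj⟩ := h
      simp only [Finset.mem_filter, Finset.mem_univ, true_and]
      exact ⟨hi, fun h => hj (hinj h)⟩
    refine le_trans ?_ (Finset.card_le_card h1)
    simp [Finset.card_erase_of_mem]
  · rw [Function.Injective] at hinj
    push Not at hinj hconst
    obtain ⟨i₁, i₂, h12, hne⟩ := hinj
    set v := f i₁ with hv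
    set F := Finset.univ.filter fun i => f i = v with hF
    have h1 : (F.erase v ×ˢ Fᶜ : Finset (Fin (n + 2) × Fin (n + 2))) ⊆
        Finset.univ.filter fun q => f q.1 ≠ q.1 ∧ f q.2 ≠ f q.1 := by
      rintro ⟨a, j⟩ h
      simp only [Finset.mem_product, Finset.mem_erase, Finset.mem_compl, hF, Finset.mem_filter,
        Finset.mem_univ, true_and] at h ⊢
      rw [h.1.2]
      exact ⟨fun h' => h.1.1 h'.symm, h.2⟩
    refine le_trans ?_ (Finset.card_le_card h1)
    rw [Finset.card_product]
    have h2 : 2 ≤ F.card := by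
      refine Finset.one_lt_card.2 ⟨i₁, ?_, i₂, ?_, hne⟩
      · simp [hF, hv]
      · simp [hF, h12]
    have h3 : 1 ≤ Fᶜ.card := by
      obtain ⟨j, hj⟩ := hconst v
      exact Finset.card_pos.2 ⟨j, by simp [hF, hj]⟩
    have h4 : F.card + Fᶜ.card = n + 2 := by
      rw [Finset.card_add_card_compl, Fintype.card_fin]
    have h5 : F.card - 1 ≤ (F.erase v).card := Finset.pred_card_le_card_erase
    obtain ⟨s, hs⟩ : ∃ s, F.card = s + 2 := ⟨F.card - 2, by omega⟩
    obtain ⟨t, ht⟩ : ∃ t, Fᶜ.card = t + 1 := ⟨Fᶜ.card - 1, by omega⟩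
    calc n ≤ (s + 1) * (t + 1) := by nlinarith
      _ ≤ _ := Nat.mul_le_mul (by omega) ht.ge

variable {V : Type*} [Fintype V] {ℓ : V → V → Fin (n + 2)} {w : V → ℝ} {p : ℝ}

lemma sum_tupleMass_and {k : ℕ} {κ : Type*} [Fintype κ] (w : V → ℝ) (S : (Fin k → V) → Prop)
    [DecidablePred S] (R : κ → (Fin k → V) → Prop) [∀ q z, Decidable (R q z)] :
    ∑ q, tupleMass w (fun z => S z ∧ R q z) =
      ∑ z with S z, ((Finset.univ.filter fun q => R q z).card : ℝ) * ∏ i, w (z i) := by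
  have h1 : ∀ q, tupleMass w (fun z => S z ∧ R q z) =
      ∑ z with S z, if R q z then ∏ j, w (z j) else 0 := by
    intro q
    rw [← Finset.sum_filter, Finset.filter_filter, tupleMass_eq]
  rw [Finset.sum_congr rfl fun q _ => h1 q, Finset.sum_comm]
  refine Finset.sum_congr rfl fun z _ => ?_
  rw [← Finset.sum_filter, Finset.sum_const, nsmul_eq_mul]

/-- An upper bound for the weight of the irregular edges: the consistent tuples that neither have
their `i`-th vertex in the part `{u | c u = i}` for all `i`, nor lie inside a part. Each of them
contains many pairs of vertices of different parts such that the first one sees the second one with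
a minority label. -/
lemma mul_tupleMass_irregular_le (hw : ∀ u, 0 ≤ w u) (h : IsOptimalWeight ℓ w p)
    (c : V → Fin (n + 2)) :
    (n : ℝ) * tupleMass w (fun z => IsConsistent ℓ z ∧ (¬ ∀ i, c (z i) = i) ∧
      ¬ ∃ l, ∀ i, c (z i) = l) ≤
    ∑ x, w x * vertexMass w (fun u => c u ≠ c x ∧ ℓ x u ≠ c x) *
      ((1 - outMass ℓ w x (c x)) / n) ^ n := by
  classical
  set κ : V → ℝ := fun x => ((1 - outMass ℓ w x (c x)) / n) ^ n with hκ
  have hout : ∀ x, 0 ≤ 1 - outMass ℓ w x (c x) := by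
    intro x
    have := vertexMass_mono hw (S := fun u => ℓ x u = c x) (T := fun _ => True) (by simp)
    rw [vertexMass_true, h.sum_eq_one] at this
    exact sub_nonneg.2 this
  have hκ0 : ∀ x, 0 ≤ κ x := fun x => pow_nonneg (div_nonneg (hout x) (Nat.cast_nonneg n)) n
  -- count each irregular tuple once for each pair `(i, j)` such that its `i`-th vertex has
  -- the wrong label and its `j`-th vertex lies in another part
  have h1 : (n : ℝ) * tupleMass w (fun z => IsConsistent ℓ z ∧ (¬ ∀ i, c (z i) = i) ∧
      ¬ ∃ l, ∀ i, c (z i) = l) ≤ ∑ q : Fin (n + 2) × Fin (n + 2),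
        tupleMass w (fun z => IsConsistent ℓ z ∧ c (z q.1) ≠ q.1 ∧ c (z q.2) ≠ c (z q.1)) := by
    rw [sum_tupleMass_and w (IsConsistent ℓ)
      fun (q : Fin (n + 2) × Fin (n + 2)) z => c (z q.1) ≠ q.1 ∧ c (z q.2) ≠ c (z q.1),
      tupleMass_eq, Finset.mul_sum]
    have hπ : ∀ z : Fin (n + 2) → V, 0 ≤ ∏ i, w (z i) := fun z =>
      Finset.prod_nonneg fun i _ => hw _
    refine (Finset.sum_le_sum fun z hz => ?_).trans (Finset.sum_le_sum_of_subset_of_nonneg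
      (Finset.monotone_filter_right _ fun z _ hz => hz.1) fun z _ _ =>
        mul_nonneg (Nat.cast_nonneg _) (hπ z))
    have hz' := (Finset.mem_filter.1 hz).2.2
    refine mul_le_mul_of_nonneg_right ?_ (hπ z)
    exact_mod_cast le_card_pairs_of_not_id_of_not_const (fun i => c (z i)) hz'.1 hz'.2
  have h2 : ∀ q : Fin (n + 2) × Fin (n + 2),
      tupleMass w (fun z => IsConsistent ℓ z ∧ c (z q.1) ≠ q.1 ∧ c (z q.2) ≠ c (z q.1)) ≤
      ∑ x, ∑ y, if (c y ≠ c x ∧ ℓ x y ≠ c x) ∧ (ℓ x y, ℓ y x) = q then w x * w y * κ x else 0 := by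
    rintro ⟨i, j⟩
    rw [← sum_tupleMass_fiber w _ fun z => z i]
    refine Finset.sum_le_sum fun x _ => ?_
    rw [← sum_tupleMass_fiber w _ fun z => z j]
    refine Finset.sum_le_sum fun y _ => ?_
    split_ifs with hxy
    · obtain ⟨⟨hc1, hc2⟩, hq⟩ := hxy
      rw [Prod.mk.injEq] at hq
      obtain ⟨rfl, rfl⟩ := hq
      rcases eq_or_ne (ℓ y x) (ℓ x y) with hij | hij
      · refine le_trans (le_of_eq ?_) (mul_nonneg (mul_nonneg (hw x) (hw y)) (hκ0 x))
        refine tupleMass_eq_zero w ?_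
        rintro z ⟨⟨⟨_, _, h3⟩, _⟩, _⟩
        simp only [hij] at h3
        exact h3 rfl
      refine (tupleMass_mono hw (T := fun z => IsConsistent ℓ z ∧ z (ℓ x y) = x ∧ z (ℓ y x) = y)
        fun z hz => ⟨hz.1.1.1, hz.1.2, hz.2⟩).trans ?_
      refine (codegreeMass_le ℓ hw x y hij).trans ?_
      refine mul_le_mul_of_nonneg_left ?_ (mul_nonneg (hw x) (hw y))
      refine (prod_pairMass_le ℓ hw _ (card_erase_erase hij) x _).trans ?_
      refine pow_le_pow_left₀ (div_nonneg (outMass_nonneg ℓ hw _ _) (Nat.cast_nonneg n)) ?_ n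
      exact div_le_div_of_nonneg_right (outMass_le_one_sub h x hc2) (Nat.cast_nonneg n)
    · refine le_of_eq ?_
      refine tupleMass_eq_zero w ?_
      rintro z ⟨⟨⟨hz, h1, h2⟩, rfl⟩, rfl⟩
      simp only at h1 h2
      have hij : i ≠ j := by rintro rfl; exact h2 rfl
      refine absurd ⟨⟨h2, ?_⟩, Prod.ext (hz i j hij) (hz j i hij.symm)⟩ hxy
      rw [hz i j hij]
      exact h1.symm
  refine h1.trans ((Finset.sum_le_sum fun q _ => h2 q).trans (le_of_eq ?_))
  rw [Finset.sum_comm]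
  refine Finset.sum_congr rfl fun x _ => ?_
  rw [Finset.sum_comm, vertexMass_eq, Finset.mul_sum, Finset.sum_mul, Finset.sum_filter]
  refine Finset.sum_congr rfl fun y _ => ?_
  by_cases hc : c y ≠ c x ∧ ℓ x y ≠ c x
  · simp [hc, hκ]
  · simp [hc]

/-- A lower bound for the weight of the transversals of the parts that are not consistent. It counts
those in which some vertex sees exactly one of the others with a label that is not its dominant one.
In the application `g x` is proportional to the weight of the minority labels at `x`. -/
lemma le_mul_tupleMass_lost (hw : ∀ u, 0 ≤ w u) (c : V → Fin (n + 2)) {g : V → ℝ}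
    (hg0 : ∀ x, 0 ≤ g x)
    (hg : ∀ x, 0 < w x → ∀ i, i ≠ c x → g x ≤ vertexMass w (fun u => c u = i ∧ ℓ x u = c x)) :
    ∑ x, w x * vertexMass w (fun u => c u ≠ c x ∧ ℓ x u ≠ c x) * g x ^ n ≤
    ((n : ℝ) + 2) * tupleMass w (fun z => (∀ i, c (z i) = i) ∧ ¬ IsConsistent ℓ z) := by
  classical
  set R : Fin (n + 2) × Fin (n + 2) → (Fin (n + 2) → V) → Prop := fun q z =>
    q.2 ≠ q.1 ∧ ℓ (z q.1) (z q.2) ≠ q.1 ∧ ∀ m, m ≠ q.1 → m ≠ q.2 → ℓ (z q.1) (z m) = q.1 with hR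
  have hπ : ∀ z : Fin (n + 2) → V, 0 ≤ ∏ i, w (z i) := fun z =>
    Finset.prod_nonneg fun i _ => hw _
  have h1 : ∑ q, tupleMass w (fun z => (∀ i, c (z i) = i) ∧ R q z) ≤
      ((n : ℝ) + 2) * tupleMass w (fun z => (∀ i, c (z i) = i) ∧ ¬ IsConsistent ℓ z) := by
    rw [sum_tupleMass_and, tupleMass_eq, Finset.mul_sum, ← Finset.filter_filter, Finset.sum_filter
      (fun z : Fin (n + 2) → V => ¬ IsConsistent ℓ z)]
    refine Finset.sum_le_sum fun z _ => ?_
    split_ifs with hz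
    · have : (Finset.univ.filter fun q => R q z) = ∅ := by
        refine Finset.filter_eq_empty_iff.2 fun q _ hq => ?_
        exact hq.2.1 (hz q.1 q.2 hq.1.symm)
      rw [this]
      simp
    · refine mul_le_mul_of_nonneg_right ?_ (hπ z)
      have h2 : (Finset.univ.filter fun q => R q z).card ≤
          (Finset.univ : Finset (Fin (n + 2))).card := by
        refine Finset.card_le_card_of_injOn Prod.fst
          (fun _ _ => Finset.mem_coe.2 (Finset.mem_univ _)) ?_
        rintro ⟨i, j⟩ hq ⟨i', j'⟩ hq' hii
        obtain rfl : i = i' := hii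
        have hq := (Finset.mem_filter.1 (Finset.mem_coe.1 hq)).2
        have hq' := (Finset.mem_filter.1 (Finset.mem_coe.1 hq')).2
        by_contra hne
        have hjj : j' ≠ j := by rintro rfl; exact hne rfl
        exact hq'.2.1 (hq.2.2 j' hq'.1 hjj)
      rw [Finset.card_univ, Fintype.card_fin] at h2
      exact_mod_cast h2
  refine le_trans ?_ h1
  have h2 : ∀ q : Fin (n + 2) × Fin (n + 2), tupleMass w (fun z => (∀ i, c (z i) = i) ∧ R q z) =
      ∑ x, tupleMass w (fun z => ((∀ i, c (z i) = i) ∧ R q z) ∧ z q.1 = x) :=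
    fun q => (sum_tupleMass_fiber w _ fun z => z q.1).symm
  rw [Finset.sum_congr rfl fun q _ => h2 q, Finset.sum_comm]
  refine Finset.sum_le_sum fun x _ => ?_
  rcases (hw x).eq_or_lt with h0 | h0
  · rw [← h0, zero_mul, zero_mul]
    exact Finset.sum_nonneg fun q _ => tupleMass_nonneg hw _
  rw [Fintype.sum_prod_type]
  refine le_trans ?_ (Finset.single_le_sum (fun i _ => Finset.sum_nonneg fun j _ =>
    tupleMass_nonneg hw _) (Finset.mem_univ (c x)))
  refine le_trans ?_ (Finset.sum_le_sum_of_subset_of_nonneg (Finset.erase_subset (c x) _)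
    fun _ _ _ => tupleMass_nonneg hw _)
  have h3 : vertexMass w (fun u => c u ≠ c x ∧ ℓ x u ≠ c x) =
      ∑ j ∈ Finset.univ.erase (c x), vertexMass w (fun u => c u = j ∧ ℓ x u ≠ c x) := by
    rw [← sum_vertexMass_fiber w _ c, ← Finset.add_sum_erase _ _ (Finset.mem_univ (c x))]
    have h4 : vertexMass w (fun u => (c u ≠ c x ∧ ℓ x u ≠ c x) ∧ c u = c x) = 0 := by
      rw [vertexMass_eq]
      exact Finset.sum_eq_zero fun u hu =>
        absurd (Finset.mem_filter.1 hu).2.2 (Finset.mem_filter.1 hu).2.1.1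
    rw [h4, zero_add]
    refine Finset.sum_congr rfl fun j hj => ?_
    congr 1
    funext u
    refine propext ⟨fun hu => ⟨hu.2, hu.1.2⟩, fun hu => ⟨⟨?_, hu.2⟩, hu.1⟩⟩
    rw [hu.1]
    exact Finset.ne_of_mem_erase hj
  rw [h3, Finset.mul_sum, Finset.sum_mul]
  refine Finset.sum_le_sum fun j hj => ?_
  have hj := Finset.ne_of_mem_erase hj
  have h5 := tupleMass_eq_and_forall w (c x) x (fun m u =>
    c u = m ∧ if m = j then ℓ x u ≠ c x else ℓ x u = c x)
  rw [← Finset.mul_prod_erase (Finset.univ.erase (c x)) _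
    (Finset.mem_erase.2 ⟨hj, Finset.mem_univ j⟩)] at h5
  have h6 : ∏ m ∈ (Finset.univ.erase (c x)).erase j,
      vertexMass w (fun u => c u = m ∧ if m = j then ℓ x u ≠ c x else ℓ x u = c x) =
      ∏ m ∈ (Finset.univ.erase (c x)).erase j, vertexMass w (fun u => c u = m ∧ ℓ x u = c x) := by
    refine Finset.prod_congr rfl fun m hm => ?_
    simp [Finset.ne_of_mem_erase hm]
  have h7 : g x ^ n ≤ ∏ m ∈ (Finset.univ.erase (c x)).erase j,
      vertexMass w (fun u => c u = m ∧ ℓ x u = c x) := by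
    have h8 : g x ^ n = ∏ _m ∈ (Finset.univ.erase (c x)).erase j, g x := by
      rw [Finset.prod_const, card_erase_erase hj]
    rw [h8]
    refine Finset.prod_le_prod (fun _ _ => hg0 x) fun m hm => hg x h0 m ?_
    exact Finset.ne_of_mem_erase (Finset.mem_of_mem_erase hm)
  rw [h6] at h5
  simp only [if_true] at h5
  calc w x * vertexMass w (fun u => c u = j ∧ ℓ x u ≠ c x) * g x ^ n
      ≤ w x * vertexMass w (fun u => c u = j ∧ ℓ x u ≠ c x) *
        ∏ m ∈ (Finset.univ.erase (c x)).erase j, vertexMass w (fun u => c u = m ∧ ℓ x u = c x) :=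
        mul_le_mul_of_nonneg_left h7 (mul_nonneg (hw x) (vertexMass_nonneg hw _))
    _ ≤ _ := by
      rw [mul_assoc, ← h5]
      refine tupleMass_mono hw ?_
      rintro z ⟨hz, hT⟩
      refine ⟨⟨fun i => ?_, hj, ?_, fun m hm hm' => ?_⟩, hz⟩
      · by_cases hi : i = c x
        · rw [hi, hz]
        · exact (hT i hi).1
      · have := (hT j hj).2
        simp only [if_true] at this
        simpa [hz] using this
      · have := (hT m hm).2
        simp only [if_neg hm'] at this
        simpa [hz] using this

/-- Inside each part the maximality of `p` itself bounds the weight of the consistent tuples. -/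
lemma IsOptimalWeight.tupleMass_inside_le (h : IsOptimalWeight ℓ w p) (c : V → Fin (n + 2)) :
    tupleMass w (fun z => IsConsistent ℓ z ∧ ∃ l, ∀ i, c (z i) = l) ≤
      p * ∑ l, vertexMass w (fun u => c u = l) ^ (n + 2) := by
  classical
  have hw := h.nonneg
  have h1 : ∀ l, tupleMass w (fun z => IsConsistent ℓ z ∧ ∀ i, c (z i) = l) ≤
      p * vertexMass w (fun u => c u = l) ^ (n + 2) := by
    intro l
    have h2 := h.mass_le (fun u => if c u = l then w u else 0)
      (fun u => by split_ifs; exacts [hw u, le_rfl])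
    rw [← Finset.sum_filter, ← vertexMass_eq] at h2
    refine le_trans (le_of_eq ?_) h2
    rw [tupleMass_eq, tupleMass_eq, ← Finset.filter_filter,
      Finset.sum_filter (fun z : Fin (n + 2) → V => ∀ i, c (z i) = l)]
    refine Finset.sum_congr rfl fun z _ => ?_
    split_ifs with hz
    · refine Finset.prod_congr rfl fun i _ => ?_
      rw [if_pos (hz i)]
    · push Not at hz
      obtain ⟨i, hi⟩ := hz
      exact (Finset.prod_eq_zero (Finset.mem_univ i) (if_neg hi)).symm
  rw [Finset.mul_sum, ← sum_tupleMass_fiber w _ fun z => c (z 0)]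
  refine Finset.sum_le_sum fun l _ => (tupleMass_mono hw ?_).trans (h1 l)
  rintro z ⟨⟨hz, l', hl'⟩, rfl⟩
  exact ⟨hz, fun i => by rw [hl', hl']⟩

/-- The maximal weight of consistent tuples is at most that of the iterated blow-up of an edge. -/
theorem IsOptimalWeight.le (h : IsOptimalWeight ℓ w p) (hn : 2 ≤ n) :
    p ≤ 1 / (((n : ℝ) + 2) ^ (n + 2) - ((n : ℝ) + 2)) := by
  classical
  by_contra hcon
  push Not at hcon
  have hw := h.nonneg
  have hn0 : (0 : ℝ) < n := by exact_mod_cast (by omega : 0 < n)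
  have hpow : 1 < ((n : ℝ) + 2) ^ (n + 1) := one_lt_pow₀ (by linarith) (by omega)
  have hden : ((n : ℝ) + 2) ^ (n + 2) - ((n : ℝ) + 2) =
      ((n : ℝ) + 2) * (((n : ℝ) + 2) ^ (n + 1) - 1) := by ring
  have hden0 : 0 < ((n : ℝ) + 2) ^ (n + 2) - ((n : ℝ) + 2) := by
    rw [hden]; exact mul_pos (by linarith) (by linarith)
  have hp0 : 0 < p := lt_trans (by positivity) hcon
  have hp : 1 / (((n : ℝ) + 2) ^ (n + 1) - 1) ≤ ((n : ℝ) + 2) * p := by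
    rw [hden, div_lt_iff₀ (by rw [← hden]; exact hden0)] at hcon
    rw [div_le_iff₀ (by linarith)]
    linarith
  obtain ⟨b, τ, hb⟩ := exists_isStabilityPair hn
  obtain ⟨c, hc⟩ := h.exists_dominant hb hp
  have hspread := fun x hx i hi => h.spread_dominant hb hn hp hc (x := x) hx (i := i) hi
  have hβ : ∀ x, 0 ≤ 1 - outMass ℓ w x (c x) := by
    intro x
    have := vertexMass_mono hw (S := fun u => ℓ x u = c x) (T := fun _ => True) (by simp)
    rw [vertexMass_true, h.sum_eq_one] at this
    exact sub_nonneg.2 this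
  set s : Fin (n + 2) → ℝ := fun i => vertexMass w fun u => c u = i with hs
  have hs0 : ∀ i, 0 ≤ s i := fun i => vertexMass_nonneg hw _
  have hs1 : ∑ i, s i = 1 := by
    have := sum_vertexMass_fiber w (fun _ => True) c
    rw [vertexMass_true, h.sum_eq_one] at this
    simpa using this
  -- the irregular edges are outweighed by the transversals that are not edges
  have hB := mul_tupleMass_irregular_le hw h c
  have hLost := le_mul_tupleMass_lost (ℓ := ℓ) hw c
    (g := fun x => τ * (1 - outMass ℓ w x (c x)))
    (fun x => mul_nonneg hb.τ_pos.le (hβ x)) hspread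
  have hBL : tupleMass w (fun z => IsConsistent ℓ z ∧ (¬ ∀ i, c (z i) = i) ∧
      ¬ ∃ l, ∀ i, c (z i) = l) ≤
      tupleMass w (fun z => (∀ i, c (z i) = i) ∧ ¬ IsConsistent ℓ z) := by
    have h1 : ((n : ℝ) + 2) / n * ∑ x, w x * vertexMass w (fun u => c u ≠ c x ∧ ℓ x u ≠ c x) *
        ((1 - outMass ℓ w x (c x)) / n) ^ n ≤
        ∑ x, w x * vertexMass w (fun u => c u ≠ c x ∧ ℓ x u ≠ c x) *
          (τ * (1 - outMass ℓ w x (c x))) ^ n := by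
      rw [Finset.mul_sum]
      refine Finset.sum_le_sum fun x _ => ?_
      have h2 : 0 ≤ w x * vertexMass w (fun u => c u ≠ c x ∧ ℓ x u ≠ c x) :=
        mul_nonneg (hw x) (vertexMass_nonneg hw _)
      have h3 := mul_le_mul_of_nonneg_right hb.spread (pow_nonneg (hβ x) n)
      calc ((n : ℝ) + 2) / n * (w x * vertexMass w (fun u => c u ≠ c x ∧ ℓ x u ≠ c x) *
            ((1 - outMass ℓ w x (c x)) / n) ^ n)
          = w x * vertexMass w (fun u => c u ≠ c x ∧ ℓ x u ≠ c x) *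
            (((n : ℝ) + 2) / n * (1 / (n : ℝ)) ^ n * (1 - outMass ℓ w x (c x)) ^ n) := by
            rw [div_pow, one_div_pow]; ring
        _ ≤ _ := by
            rw [mul_pow]
            exact mul_le_mul_of_nonneg_left h3 h2
    have h4 := mul_le_mul_of_nonneg_left hB (by positivity : 0 ≤ ((n : ℝ) + 2) / n)
    have h5 := (h4.trans h1).trans hLost
    rw [← mul_assoc, div_mul_cancel₀ _ hn0.ne'] at h5
    exact le_of_mul_le_mul_left h5 (by linarith)
  -- hence the weight is at most that of all transversals plus that of the edges inside the parts
  have hmain : p ≤ ∏ i, s i + p * ∑ i, s i ^ (n + 2) := by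
    have h1 := tupleMass_and_add_and_not w (IsConsistent ℓ) fun z => ∀ i, c (z i) = i
    have h2 := tupleMass_and_add_and_not w (fun z => ∀ i, c (z i) = i) (IsConsistent ℓ)
    have h3 := tupleMass_and_add_and_not w (fun z => IsConsistent ℓ z ∧ ¬ ∀ i, c (z i) = i)
      fun z => ∃ l, ∀ i, c (z i) = l
    have h4 := h.tupleMass_inside_le c
    have h5 := tupleMass_forall w fun (i : Fin (n + 2)) u => c u = i
    have h6 : tupleMass w (fun z => (IsConsistent ℓ z ∧ ¬ ∀ i, c (z i) = i) ∧
        ∃ l, ∀ i, c (z i) = l) ≤ tupleMass w (fun z => IsConsistent ℓ z ∧ ∃ l, ∀ i, c (z i) = l) :=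
      tupleMass_mono hw fun z hz => ⟨hz.1.1, hz.2⟩
    have h7 : tupleMass w (fun z => IsConsistent ℓ z ∧ ∀ i, c (z i) = i) =
        tupleMass w (fun z => (∀ i, c (z i) = i) ∧ IsConsistent ℓ z) := by
      simp only [and_comm]
    simp only [and_assoc] at h3 hBL h6
    rw [h.mass_eq] at h1
    linarith
  by_cases hone : ∃ x y, 0 < w x ∧ 0 < w y ∧ c x ≠ c y
  · obtain ⟨x, y, hx, hy, hxy⟩ := hone
    have hpos : ∀ x, 0 < w x → 0 < s (c x) := fun x hx =>
      lt_of_lt_of_le hx (by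
        rw [← vertexMass_eq_self w x]
        exact vertexMass_mono hw fun u hu => by rw [hu])
    have hlt : ∀ i, s i < 1 := by
      intro i
      obtain ⟨j, hj, hji⟩ : ∃ j, 0 < s j ∧ j ≠ i := by
        by_cases hi : c x = i
        · exact ⟨c y, hpos y hy, fun h => hxy (hi.trans h.symm)⟩
        · exact ⟨c x, hpos x hx, hi⟩
      have : s j + s i ≤ ∑ i, s i := by
        rw [← Finset.sum_pair hji]
        exact Finset.sum_le_sum_of_subset_of_nonneg (Finset.subset_univ _) fun m _ _ => hs0 m
      linarith
    have hsum : ∑ i, s i ^ (n + 2) < 1 := by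
      rw [← hs1]
      refine Finset.sum_lt_sum (fun i _ => pow_le_of_le_one (hs0 i) (hlt i).le (by omega))
        ⟨c x, Finset.mem_univ _, ?_⟩
      exact pow_lt_self_of_lt_one₀ (hpos x hx) (hlt _) (by omega)
    have hamgm := prod_le_one_sub_sum_pow s hs0 hs1
    push_cast at hamgm
    have h1 : p * (((n : ℝ) + 2) ^ (n + 2) - ((n : ℝ) + 2)) ≤ 1 := by
      have h2 : (((n : ℝ) + 2) ^ (n + 2) - ((n : ℝ) + 2)) * (p * (1 - ∑ i, s i ^ (n + 2))) ≤
          1 * (1 - ∑ i, s i ^ (n + 2)) := by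
        rw [one_mul]
        refine le_trans (mul_le_mul_of_nonneg_left ?_ hden0.le) hamgm
        linarith
      rw [← mul_assoc] at h2
      have := le_of_mul_le_mul_right h2 (by linarith)
      linarith
    rw [div_lt_iff₀ hden0] at hcon
    linarith
  · -- if all the weight is in one part, then no vertex sees anything with another label
    push Not at hone
    obtain ⟨x₀, hx₀⟩ : ∃ x, 0 < w x := by
      by_contra hno
      push Not at hno
      have := Finset.sum_nonpos fun u (_ : u ∈ Finset.univ) => hno u
      rw [h.sum_eq_one] at this
      linarith
    obtain ⟨i, hi⟩ := exists_ne (c x₀)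
    have h1 : ∀ x, incidentMass ℓ w x i ≤ 0 := by
      intro x
      refine (incidentMass_le_pow hw x i).trans ?_
      rcases (hw x).eq_or_lt with h0 | h0
      · rw [← h0, zero_mul]
      have hcx := hone x x₀ h0 hx₀
      have h2 := hspread x h0 i (by rw [hcx]; exact hi)
      have h3 : vertexMass w (fun u => c u = i ∧ ℓ x u = c x) ≤ 0 := by
        rw [vertexMass_eq]
        refine Finset.sum_nonpos fun u hu => ?_
        by_contra hu'
        push Not at hu'
        exact hi (by rw [← (Finset.mem_filter.1 hu).2.1, hone u x₀ hu' hx₀])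
      have h4 : 1 - outMass ℓ w x (c x) ≤ 0 := by
        by_contra h5
        push Not at h5
        linarith [mul_pos hb.τ_pos h5]
      have h5 := outMass_le_one_sub h x (i := i) (j := c x) (by rw [hcx]; exact hi)
      have h6 := outMass_nonneg ℓ hw x i
      have h7 : outMass ℓ w x i = 0 := by linarith
      rw [h7]
      simp
    have h2 : p ≤ 0 := by
      rw [← h.mass_eq, ← sum_tupleMass_fiber w _ fun z => z i]
      exact Finset.sum_nonpos fun x _ => h1 x
    linarith

end UpperBound

/-! ### From weights to edge counts -/

section Count

variable {V : Type*} {k : ℕ}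

/-- If the `i`-th and the `j`-th vertex coincide, then they see a third vertex of the tuple with the
same label, so that `i = j`. -/
lemma IsConsistent.injective {ℓ : V → V → Fin k} (hk : 3 ≤ k) {z : Fin k → V}
    (hz : IsConsistent ℓ z) : Function.Injective z := by
  intro i j hij
  by_contra hne
  obtain ⟨m, hm⟩ : ∃ m, m ∉ ({i, j} : Finset (Fin k)) := by
    by_contra hcon
    push Not at hcon
    have h1 := Finset.card_le_card fun m (_ : m ∈ Finset.univ) => hcon m
    have h2 := Finset.card_le_two (a := i) (b := j)
    rw [Finset.card_univ, Fintype.card_fin] at h1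
    omega
  simp only [Finset.mem_insert, Finset.mem_singleton, not_or] at hm
  have h1 := hz i m (Ne.symm hm.1)
  have h2 := hz j m (Ne.symm hm.2)
  rw [hij] at h1
  exact hne (h1.symm.trans h2)

variable [Fintype V]

open Classical in
/-- The number of consistent tuples with all entries in `W`. -/
noncomputable def tupleCount (ℓ : V → V → Fin k) (W : Finset V) : ℕ :=
  (Finset.univ.filter fun z : Fin k → V => IsConsistent ℓ z ∧ ∀ i, z i ∈ W).card

lemma tupleCount_eq (ℓ : V → V → Fin k) (W : Finset V)
    [DecidablePred fun z : Fin k → V => IsConsistent ℓ z ∧ ∀ i, z i ∈ W] :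
    tupleCount ℓ W =
      (Finset.univ.filter fun z : Fin k → V => IsConsistent ℓ z ∧ ∀ i, z i ∈ W).card := by
  unfold tupleCount
  congr!

open Classical in
lemma tupleMass_indicator (ℓ : V → V → Fin k) (W : Finset V) :
    tupleMass (fun u => if u ∈ W then 1 else 0) (IsConsistent ℓ) = tupleCount ℓ W := by
  rw [tupleMass_eq, tupleCount, ← Finset.filter_filter, Finset.card_eq_sum_ones, Finset.sum_filter
    (fun z : Fin k → V => ∀ i, z i ∈ W)]
  push_cast
  refine Finset.sum_congr rfl fun z _ => ?_
  rw [Finset.prod_ite_zero]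
  simp

lemma tupleMass_smul (w : V → ℝ) (S : (Fin k → V) → Prop) (a : ℝ) :
    tupleMass (fun u => a * w u) S = a ^ k * tupleMass w S := by
  classical
  simp only [tupleMass_eq, Finset.mul_sum, Finset.prod_mul_distrib, Finset.prod_const,
    Finset.card_univ, Fintype.card_fin]

lemma exists_isOptimalWeight [Nonempty V] {n : ℕ} (ℓ : V → V → Fin (n + 2)) :
    ∃ w p, IsOptimalWeight ℓ w p := by
  classical
  have hne : (stdSimplex ℝ V).Nonempty :=
    ⟨_, single_mem_stdSimplex ℝ (Classical.arbitrary V)⟩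
  have hcont : Continuous fun w : V → ℝ => tupleMass w (IsConsistent ℓ) := by
    simp only [tupleMass_eq]
    fun_prop
  obtain ⟨w, hw, hmax⟩ := (isCompact_stdSimplex ℝ V).exists_isMaxOn hne hcont.continuousOn
  refine ⟨w, _, hw.1, hw.2, rfl, fun w' hw' => ?_⟩
  rcases (Finset.sum_nonneg fun u (_ : u ∈ Finset.univ) => hw' u).eq_or_lt with h0 | h0
  · rw [← h0, zero_pow (by omega), mul_zero]
    rw [eq_comm, Finset.sum_eq_zero_iff_of_nonneg fun u _ => hw' u] at h0
    rw [tupleMass_eq]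
    refine (Finset.sum_eq_zero fun z _ => ?_).le
    exact Finset.prod_eq_zero (Finset.mem_univ 0) (h0 _ (Finset.mem_univ _))
  · set σ := ∑ u, w' u with hσ
    have h1 : (fun u => σ⁻¹ * w' u) ∈ stdSimplex ℝ V := by
      refine ⟨fun u => mul_nonneg (inv_nonneg.2 h0.le) (hw' u), ?_⟩
      rw [← Finset.mul_sum, ← hσ, inv_mul_cancel₀ h0.ne']
    have h2 : tupleMass (fun u => σ⁻¹ * w' u) (IsConsistent ℓ) ≤ tupleMass w (IsConsistent ℓ) :=
      hmax h1
    rw [tupleMass_smul, inv_pow, inv_mul_le_iff₀ (by positivity)] at h2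
    linarith

/-- The upper bound for an unweighted vertex set. -/
lemma tupleCount_le {k : ℕ} (hk : 4 ≤ k) (ℓ : V → V → Fin k) (W : Finset V) :
    (tupleCount ℓ W : ℝ) ≤ 1 / ((k : ℝ) ^ k - k) * (W.card : ℝ) ^ k := by
  classical
  obtain ⟨n, rfl⟩ : ∃ n, k = n + 2 := ⟨k - 2, by omega⟩
  rcases isEmpty_or_nonempty V with hV | hV
  · have h1 : tupleCount ℓ W = 0 := by
      rw [tupleCount_eq, Finset.card_eq_zero]
      exact Finset.filter_false_of_mem fun z _ => (hV.false (z 0)).elim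
    have h2 : W.card = 0 := by
      rw [Finset.card_eq_zero]
      exact Finset.eq_empty_of_isEmpty W
    rw [h1, h2]
    simp
  obtain ⟨w, p, h⟩ := exists_isOptimalWeight ℓ
  have h1 := h.mass_le (fun u => if u ∈ W then 1 else 0) (fun u => by split_ifs <;> norm_num)
  rw [tupleMass_indicator] at h1
  have h2 := h.le (by omega)
  simp only [Finset.sum_boole, Finset.filter_univ_mem] at h1
  refine h1.trans ?_
  push_cast
  gcongr

end Count

/-! ### The hypergraph of a labelling -/

section Graph

variable {V : Type} {k : ℕ}

namespace KGraph

lemma card_edges_induce (H : KGraph k V) (S : Finset V) [DecidablePred fun e : Finset V => e ⊆ S] :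
    (H.induce S).edges.card = (H.edges.filter fun e => e ⊆ S).card := by
  classical
  refine Finset.card_bij (fun e _ => e.map (Function.Embedding.subtype _)) ?_ ?_ ?_
  · intro e he
    refine Finset.mem_filter.2 ⟨(Finset.mem_filter.1 he).2, fun v hv => ?_⟩
    obtain ⟨u, -, rfl⟩ := Finset.mem_map.1 hv
    exact u.2
  · intro e _ e' _ h
    exact Finset.map_injective _ h
  · intro e he
    obtain ⟨he, heS⟩ := Finset.mem_filter.1 he
    have h1 : (e.subtype (· ∈ S)).map (Function.Embedding.subtype _) = e :=
      Finset.subtype_map_of_mem fun v hv => heS hv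
    refine ⟨e.subtype (· ∈ S), Finset.mem_filter.2 ⟨Finset.mem_univ _, ?_⟩, h1⟩
    rw [h1]
    exact he

lemma density_induce (H : KGraph k V) (S : Finset V) :
    (H.induce S).density = ((H.induce S).edges.card : ℝ) / (S.card.choose k : ℝ) := by
  rw [density, Fintype.card_coe]

/-- Deleting a suitable vertex does not lower the density. -/
lemma exists_density_le_erase [DecidableEq V] (H : KGraph k V) (S : Finset V) (hS : k < S.card) :
    ∃ v ∈ S, (H.induce S).density ≤ (H.induce (S.erase v)).density := by
  classical
  obtain ⟨t, ht⟩ : ∃ t, S.card = t + 1 := ⟨S.card - 1, by omega⟩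
  have hne : S.Nonempty := Finset.card_pos.1 (by omega)
  have hsum : ∑ v ∈ S, (H.induce (S.erase v)).edges.card =
      (t + 1 - k) * (H.induce S).edges.card := by
    simp only [card_edges_induce, Finset.card_filter]
    rw [Finset.sum_comm, Finset.mul_sum]
    refine Finset.sum_congr rfl fun e he => ?_
    rw [← Finset.card_filter]
    split_ifs with heS
    · have h1 : (S.filter fun v => e ⊆ S.erase v) = S \ e := by
        ext v
        simp only [Finset.mem_filter, Finset.mem_sdiff, Finset.subset_erase, heS, true_and]
      rw [h1, Finset.card_sdiff_of_subset heS, H.uniform e he, ht, mul_one]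
    · rw [Finset.card_eq_zero.2, mul_zero]
      exact Finset.filter_false_of_mem fun v _ h => heS (h.trans (Finset.erase_subset _ _))
  obtain ⟨v, hv, hle⟩ : ∃ v ∈ S, (t + 1 - k) * (H.induce S).edges.card ≤
      (t + 1) * (H.induce (S.erase v)).edges.card := by
    by_contra hcon
    push Not at hcon
    have h1 := Finset.sum_lt_sum_of_nonempty hne hcon
    rw [← Finset.mul_sum, hsum, Finset.sum_const, ht, smul_eq_mul] at h1
    exact lt_irrefl _ h1
  refine ⟨v, hv, ?_⟩
  rw [density_induce, density_induce, Finset.card_erase_of_mem hv, ht, Nat.add_sub_cancel]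
  have hc := Nat.choose_mul_succ_eq t k
  have h1 : 0 < t.choose k := Nat.choose_pos (by omega)
  have h2 : 0 < (t + 1).choose k := Nat.choose_pos (by omega)
  rw [div_le_div_iff₀ (by exact_mod_cast h2) (by exact_mod_cast h1)]
  norm_cast
  have h3 : 0 < t + 1 - k := by omega
  refine Nat.le_of_mul_le_mul_right (c := t + 1) ?_ (by omega)
  calc (H.induce S).edges.card * t.choose k * (t + 1)
      = (t + 1 - k) * (H.induce S).edges.card * (t + 1).choose k := by
        rw [mul_assoc, hc]; ring
    _ ≤ (t + 1) * (H.induce (S.erase v)).edges.card * (t + 1).choose k :=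
        Nat.mul_le_mul_right _ hle
    _ = _ := by ring

lemma exists_subset_density_le (H : KGraph k V) (T : Finset V) {s : ℕ} (hs : k ≤ s)
    (hsT : s ≤ T.card) :
    ∃ S ⊆ T, S.card = s ∧ (H.induce T).density ≤ (H.induce S).density := by
  classical
  obtain ⟨r, hr⟩ := Nat.exists_eq_add_of_le hsT
  induction r generalizing T with
  | zero => exact ⟨T, subset_rfl, by omega, le_rfl⟩
  | succ r ih =>
    obtain ⟨v, hv, hle⟩ := H.exists_density_le_erase T (by omega)
    have hcard := Finset.card_erase_of_mem hv
    obtain ⟨S, hST, hS, hle'⟩ := ih (T.erase v) (by omega) (by omega)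
    exact ⟨S, hST.trans (Finset.erase_subset _ _), hS, hle.trans hle'⟩

end KGraph

variable [Fintype V]

open Classical in
/-- The `k`-graph of a labelling: its edges are the `k`-sets whose vertices can be ordered to a
consistent tuple. -/
noncomputable def labelGraph (ℓ : V → V → Fin k) : KGraph k V where
  edges := Finset.univ.filter fun e =>
    e.card = k ∧ ∃ z : Fin k → V, IsConsistent ℓ z ∧ Finset.univ.image z = e
  uniform := fun _ he => (Finset.mem_filter.1 he).2.1

/-- The order in which an edge is consistent is unique, because each vertex of the edge sees the
other ones with the label that is its own position. -/
lemma card_edges_induce_labelGraph (hk : 3 ≤ k) (ℓ : V → V → Fin k) (W : Finset V) :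
    ((labelGraph ℓ).induce W).edges.card = tupleCount ℓ W := by
  classical
  rw [KGraph.card_edges_induce, tupleCount]
  symm
  refine Finset.card_bij (fun z _ => Finset.univ.image z) ?_ ?_ ?_
  · intro z hz
    obtain ⟨hz, hW⟩ := (Finset.mem_filter.1 hz).2
    refine Finset.mem_filter.2 ⟨Finset.mem_filter.2 ⟨Finset.mem_univ _, ?_, z, hz, by congr!⟩, ?_⟩
    · rw [Finset.card_image_of_injective _ (hz.injective hk), Finset.card_univ, Fintype.card_fin]
    · intro v hv
      obtain ⟨i, -, rfl⟩ := Finset.mem_image.1 hv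
      exact hW i
  · intro z hz z' hz' himage
    have hz := (Finset.mem_filter.1 hz).2.1
    have hz' := (Finset.mem_filter.1 hz').2.1
    have hσ : ∀ i, ∃ j, z j = z' i := by
      intro i
      have h1 : z' i ∈ Finset.univ.image z := by
        rw [himage]
        exact Finset.mem_image_of_mem _ (Finset.mem_univ i)
      obtain ⟨j, -, hj⟩ := Finset.mem_image.1 h1
      exact ⟨j, hj⟩
    choose σ hσ using hσ
    have hσ_inj : Function.Injective σ := fun i j hij =>
      hz'.injective hk (by rw [← hσ i, ← hσ j, hij])
    funext i
    obtain ⟨j, hj⟩ : ∃ j : Fin k, j ≠ i := by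
      have : Nontrivial (Fin k) := Fin.nontrivial_iff_two_le.2 (by omega)
      exact exists_ne i
    have h1 := hz' i j hj.symm
    rw [← hσ i, ← hσ j, hz (σ i) (σ j) fun h => hj (hσ_inj h).symm] at h1
    rw [← hσ i, h1]
  · intro e he
    obtain ⟨he, heW⟩ := Finset.mem_filter.1 he
    obtain ⟨-, z, hz, rfl⟩ := (Finset.mem_filter.1 he).2
    refine ⟨z, Finset.mem_filter.2 ⟨Finset.mem_univ _, hz, fun i => heW ?_⟩, by congr!⟩
    exact Finset.mem_image_of_mem _ (Finset.mem_univ i)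

end Graph

/-! ### The universal labelling and iterated blow-ups -/

section Universal

variable {k : ℕ}

/-- The vertices are pairs of a function `Fin m → Fin k` and a point of `Fin m`; a vertex sees
another one with the value of its function at the point of the other one. -/
def evalLabel (k m : ℕ) (u v : (Fin m → Fin k) × Fin m) : Fin k := u.1 v.2

lemma tupleCount_map {V V' : Type*} [Fintype V] [Fintype V'] (ℓ : V → V → Fin k)
    (ℓ' : V' → V' → Fin k) (φ : V' ↪ V) (hφ : ∀ u v, ℓ (φ u) (φ v) = ℓ' u v) :
    tupleCount ℓ' Finset.univ ≤ tupleCount ℓ (Finset.univ.map φ) := by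
  classical
  refine Finset.card_le_card_of_injOn (fun z i => φ (z i)) ?_ ?_
  · intro z hz
    have hz := (Finset.mem_filter.1 (Finset.mem_coe.1 hz)).2.1
    refine Finset.mem_coe.2
      (Finset.mem_filter.2 ⟨Finset.mem_univ _, fun i j hij => ?_, fun i => ?_⟩)
    · rw [hφ]
      exact hz i j hij
    · exact Finset.mem_map_of_mem _ (Finset.mem_univ _)
  · intro z _ z' _ h
    funext i
    exact φ.injective (congrFun h i)

/-- Every labelling of a finite set is induced by the labelling `evalLabel`. -/
lemma exists_le_tupleCount_evalLabel {V' : Type*} [Fintype V'] (ℓ' : V' → V' → Fin k) :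
    ∃ T : Finset ((Fin (Fintype.card V') → Fin k) × Fin (Fintype.card V')),
      T.card = Fintype.card V' ∧
      tupleCount ℓ' Finset.univ ≤ tupleCount (evalLabel k (Fintype.card V')) T := by
  classical
  set e := Fintype.equivFin V'
  refine ⟨Finset.univ.map ⟨fun u => (fun t => ℓ' u (e.symm t), e u), fun u v h =>
    e.injective (Prod.mk.inj h).2⟩, by simp, tupleCount_map _ _ _ fun u v => ?_⟩
  exact congrArg (ℓ' u) (e.symm_apply_apply v)

/-- The labelling of the iterated blow-up of an edge: the vertices are words of length `d`, and a
word sees another one with its letter at the first position where the two words differ. The label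
`0` of a pair of equal words is arbitrary. -/
def wordLabel (k : ℕ) [NeZero k] : (d : ℕ) → (Fin d → Fin k) → (Fin d → Fin k) → Fin k
  | 0 => fun _ _ => 0
  | d + 1 => fun u v => if u 0 = v 0 then wordLabel k d (Fin.tail u) (Fin.tail v) else u 0

/-- A consistent tuple of words either has a common first letter, and is consistent after its
removal, or consists of words with the first letters `0, 1, …, k - 1`, in this order, and all of
these are consistent. Only the resulting lower bound is needed. -/
lemma le_tupleCount_wordLabel_succ [NeZero k] (hk : 2 ≤ k) (d : ℕ) :
    k * tupleCount (wordLabel k d) Finset.univ + (k ^ d) ^ k ≤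
      tupleCount (wordLabel k (d + 1)) Finset.univ := by
  classical
  set A : Finset (Fin k × (Fin k → Fin d → Fin k)) := Finset.univ ×ˢ
    Finset.univ.filter fun z : Fin k → Fin d → Fin k =>
      IsConsistent (wordLabel k d) z ∧ ∀ i, z i ∈ Finset.univ with hA
  have hcard : k * tupleCount (wordLabel k d) Finset.univ + (k ^ d) ^ k =
      (A.disjSum (Finset.univ : Finset (Fin k → Fin d → Fin k))).card := by
    rw [Finset.card_disjSum, hA, Finset.card_product, tupleCount]
    simp
  rw [hcard, tupleCount_eq]
  have : Nontrivial (Fin k) := Fin.nontrivial_iff_two_le.2 hk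
  refine Finset.card_le_card_of_injOn (Sum.elim (fun q i => Fin.cons q.1 (q.2 i))
    fun y i => Fin.cons i (y i)) ?_ ?_
  · rintro (⟨a, z⟩ | y) h
    · have hz := (Finset.mem_filter.1 (Finset.mem_product.1
        (Finset.inl_mem_disjSum.1 (Finset.mem_coe.1 h))).2).2.1
      refine Finset.mem_coe.2 (Finset.mem_filter.2 ⟨Finset.mem_univ _, fun i j hij => ?_, by simp⟩)
      simpa [wordLabel] using hz i j hij
    · refine Finset.mem_coe.2 (Finset.mem_filter.2 ⟨Finset.mem_univ _, fun i j hij => ?_, by simp⟩)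
      simp [wordLabel, hij]
  · have hcons : ∀ {a b : Fin k} {u v : Fin d → Fin k},
        (Fin.cons a u : Fin (d + 1) → Fin k) = Fin.cons b v → a = b ∧ u = v :=
      fun h => Fin.cons_inj.1 h
    obtain ⟨i₀, i₁, hne⟩ := exists_pair_ne (Fin k)
    rintro (⟨a, z⟩ | y) - (⟨a', z'⟩ | y') - h
    · have h1 := fun i => hcons (congrFun h i)
      exact congrArg Sum.inl (Prod.ext (h1 0).1 (funext fun i => (h1 i).2))
    · have h1 := fun i => (hcons (congrFun h i)).1
      exact absurd ((h1 i₀).symm.trans (h1 i₁)) hne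
    · have h1 := fun i => (hcons (congrFun h i)).1
      exact absurd ((h1 i₀).trans (h1 i₁).symm) hne
    · have h1 := fun i => (hcons (congrFun h i)).2
      rw [funext h1]

lemma le_tupleCount_wordLabel [NeZero k] (hk : 2 ≤ k) (d : ℕ) :
    ((k : ℝ) ^ d) ^ k - (k : ℝ) ^ d ≤
      ((k : ℝ) ^ k - k) * tupleCount (wordLabel k d) Finset.univ := by
  have hk' : (k : ℝ) ≤ (k : ℝ) ^ k := by
    have : (1 : ℝ) ≤ k := by exact_mod_cast (by omega : 1 ≤ k)
    exact le_self_pow₀ this (by omega)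
  induction d with
  | zero =>
    simp only [pow_zero, one_pow, sub_self]
    exact mul_nonneg (sub_nonneg.2 hk') (Nat.cast_nonneg _)
  | succ d ih =>
    have h1 : (k : ℝ) * tupleCount (wordLabel k d) Finset.univ + ((k : ℝ) ^ d) ^ k ≤
        tupleCount (wordLabel k (d + 1)) Finset.univ := by
      exact_mod_cast le_tupleCount_wordLabel_succ hk d
    have h2 := mul_le_mul_of_nonneg_left h1 (sub_nonneg.2 hk')
    have h3 := mul_le_mul_of_nonneg_left ih (Nat.cast_nonneg (α := ℝ) k)
    refine le_trans (le_of_eq ?_) (le_trans (add_le_add_left h3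
      (((k : ℝ) ^ k - k) * ((k : ℝ) ^ d) ^ k)) (le_trans (le_of_eq ?_) h2))
    · rw [pow_succ, mul_pow]; ring
    · ring

end Universal

/-! ### Quasirandomness of the universal labelling -/

section Quasirandom

variable {k m : ℕ}

lemma sum_indicator_sub_inv [NeZero k] (i : Fin k) :
    ∑ t : Fin k, ((if t = i then 1 else 0 : ℝ) - 1 / k) = 0 := by
  have hk : (k : ℝ) ≠ 0 := Nat.cast_ne_zero.2 (NeZero.ne k)
  rw [Finset.sum_sub_distrib]
  simp [hk]

lemma abs_indicator_sub_inv_le [NeZero k] (P : Prop) [Decidable P] :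
    |(if P then 1 else 0 : ℝ) - 1 / k| ≤ 1 := by
  have hk : (1 : ℝ) ≤ k := by exact_mod_cast NeZero.pos k
  have h1 : 1 / (k : ℝ) ≤ 1 := by rw [div_le_one (by linarith)]; exact hk
  have h2 : 0 < 1 / (k : ℝ) := by positivity
  rw [abs_le]
  split_ifs <;> constructor <;> linarith

/-- The values of a random function at different points are independent. -/
lemma sum_eval_mul_eval_eq_zero (e : Fin k → ℝ) (he : ∑ t, e t = 0) {x y : Fin m} (hxy : y ≠ x) :
    ∑ g : Fin m → Fin k, e (g x) * e (g y) = 0 := by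
  rw [Fintype.sum_equiv (Equiv.funSplitAt x (Fin k)) _
    (fun q : Fin k × ({j // j ≠ x} → Fin k) => e q.1 * e (q.2 ⟨y, hxy⟩)) fun g => by
      simp [Equiv.funSplitAt, Equiv.piSplitAt], Fintype.sum_prod_type_right]
  refine Finset.sum_eq_zero fun h _ => ?_
  simp only
  rw [← Finset.sum_mul, he, zero_mul]

/-- The matrix with rows indexed by functions and columns indexed by points, that records where a
function takes the value `i`, has small cut norm. -/
lemma abs_sum_mul_eval_le [NeZero k] (i : Fin k) (a : (Fin m → Fin k) → ℝ) (b : Fin m → ℝ)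
    (ha : ∀ g, |a g| ≤ 1) (hb : ∀ x, |b x| ≤ 1) :
    |∑ g, ∑ x, a g * b x * ((if g x = i then 1 else 0 : ℝ) - 1 / k)| ≤ (k : ℝ) ^ m * √m := by
  set e : Fin k → ℝ := fun t => (if t = i then 1 else 0 : ℝ) - 1 / k with he
  have he0 : ∑ t, e t = 0 := sum_indicator_sub_inv i
  have he1 : ∀ t, |e t| ≤ 1 := fun t => abs_indicator_sub_inv_le _
  have hsq : ∀ r : ℝ, |r| ≤ 1 → r ^ 2 ≤ 1 := fun r hr => by
    rw [← sq_abs]; exact pow_le_one₀ (abs_nonneg r) hr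
  have h1 : ∑ g : Fin m → Fin k, (∑ x, b x * e (g x)) ^ 2 ≤ (k : ℝ) ^ m * m := by
    have h2 : ∀ g : Fin m → Fin k, (∑ x, b x * e (g x)) ^ 2 =
        ∑ x, ∑ y, b x * b y * (e (g x) * e (g y)) := by
      intro g
      rw [sq, Finset.sum_mul_sum]
      refine Finset.sum_congr rfl fun x _ => Finset.sum_congr rfl fun y _ => by ring
    calc ∑ g : Fin m → Fin k, (∑ x, b x * e (g x)) ^ 2
        = ∑ x, ∑ y, b x * b y * ∑ g : Fin m → Fin k, e (g x) * e (g y) := by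
          rw [Finset.sum_congr rfl fun g _ => h2 g, Finset.sum_comm]
          refine Finset.sum_congr rfl fun x _ => ?_
          rw [Finset.sum_comm]
          exact Finset.sum_congr rfl fun y _ => (Finset.mul_sum _ _ _).symm
      _ = ∑ x, b x * b x * ∑ g : Fin m → Fin k, e (g x) * e (g x) := by
          refine Finset.sum_congr rfl fun x _ => ?_
          refine Finset.sum_eq_single x (fun y _ hy => ?_) fun h => absurd (Finset.mem_univ x) h
          rw [sum_eval_mul_eval_eq_zero e he0 hy, mul_zero]
      _ ≤ ∑ _x : Fin m, 1 * (k : ℝ) ^ m := by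
          refine Finset.sum_le_sum fun x _ => ?_
          refine mul_le_mul ?_ ?_ (Finset.sum_nonneg fun g _ => mul_self_nonneg _) zero_le_one
          · rw [← sq]; exact hsq _ (hb x)
          · calc ∑ g : Fin m → Fin k, e (g x) * e (g x) ≤ ∑ _g : Fin m → Fin k, (1 : ℝ) :=
                  Finset.sum_le_sum fun g _ => by rw [← sq]; exact hsq _ (he1 _)
              _ = (k : ℝ) ^ m := by simp
      _ = (k : ℝ) ^ m * m := by simp [mul_comm]
  have h3 : ∑ g, ∑ x, a g * b x * e (g x) = ∑ g, a g * ∑ x, b x * e (g x) := by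
    refine Finset.sum_congr rfl fun g _ => ?_
    rw [Finset.mul_sum]
    exact Finset.sum_congr rfl fun x _ => by ring
  have h4 : ∑ g, a g ^ 2 ≤ (k : ℝ) ^ m := by
    calc ∑ g, a g ^ 2 ≤ ∑ _g : Fin m → Fin k, (1 : ℝ) :=
          Finset.sum_le_sum fun g _ => hsq _ (ha g)
      _ = (k : ℝ) ^ m := by simp
  have h5 : (∑ g, a g * ∑ x, b x * e (g x)) ^ 2 ≤ ((k : ℝ) ^ m * √m) ^ 2 := by
    refine (Finset.sum_mul_sq_le_sq_mul_sq _ _ _).trans ?_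
    rw [mul_pow, Real.sq_sqrt (Nat.cast_nonneg m), sq, mul_assoc]
    exact mul_le_mul h4 h1 (Finset.sum_nonneg fun g _ => sq_nonneg _) (by positivity)
  rw [h3]
  exact abs_le_of_sq_le_sq h5 (by positivity)

/-- Replace the function of the `i`-th vertex of a tuple by `g` and the point of its `j`-th vertex
by `x`. -/
def replaceAt (i j : Fin k) (z : Fin k → (Fin m → Fin k) × Fin m) (g : Fin m → Fin k) (x : Fin m) :
    Fin k → (Fin m → Fin k) × Fin m :=
  fun l => (if l = i then g else (z l).1, if l = j then x else (z l).2)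

lemma sum_replaceAt (i j : Fin k) (F : (Fin k → (Fin m → Fin k) × Fin m) → ℝ) :
    ∑ z, ∑ g, ∑ x, F (replaceAt i j z g x) = (k : ℝ) ^ m * m * ∑ z, F z := by
  have hinv : Function.Involutive
      fun q : (Fin k → (Fin m → Fin k) × Fin m) × (Fin m → Fin k) × Fin m =>
        (replaceAt i j q.1 q.2.1 q.2.2, (q.1 i).1, (q.1 j).2) := by
    rintro ⟨z, g, x⟩
    simp only [replaceAt, if_true, Prod.mk.injEq, and_true]
    funext l
    refine Prod.ext ?_ ?_
    · by_cases h : l = i <;> simp [replaceAt, h]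
    · by_cases h : l = j <;> simp [replaceAt, h]
  have h1 := Fintype.sum_equiv hinv.toPerm (fun q => F (replaceAt i j q.1 q.2.1 q.2.2))
    (fun q => F q.1) fun q => rfl
  simp only [Fintype.sum_prod_type] at h1
  rw [h1, Finset.mul_sum]
  simp [mul_assoc]

open Classical in
/-- The number of tuples in `W` in which the pairs of positions in `S` have the labels that they
have in a consistent tuple. -/
noncomputable def partialCount (k m : ℕ) (W : Finset ((Fin m → Fin k) × Fin m))
    (S : Finset (Fin k × Fin k)) : ℝ :=
  ∑ z : Fin k → (Fin m → Fin k) × Fin m,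
    (∏ l, if z l ∈ W then 1 else 0) * ∏ q ∈ S, if (z q.1).1 (z q.2).2 = q.1 then 1 else 0

/-- Imposing the label of one more pair of positions multiplies the number of tuples by about
`1 / k`. After fixing everything but the function of the `i`-th vertex and the point of the `j`-th
vertex, all the other conditions depend on only one of the two. -/
lemma abs_partialCount_insert_sub_le [NeZero k] (W : Finset ((Fin m → Fin k) × Fin m))
    {S : Finset (Fin k × Fin k)} {i j : Fin k} (hij : i ≠ j) (hS : (i, j) ∉ S) :
    |partialCount k m W (insert (i, j) S) - partialCount k m W S / k| ≤
      ((k : ℝ) ^ m * m) ^ k / √m := by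
  classical
  rcases Nat.eq_zero_or_pos m with rfl | hm
  · have h0 : ∀ S, partialCount k 0 W S = 0 := fun S => by
      rw [partialCount]
      exact Finset.sum_eq_zero fun z _ => (z 0).2.elim0
    simp [h0]
  set F : (Fin k → (Fin m → Fin k) × Fin m) → ℝ := fun z =>
    ((∏ l, if z l ∈ W then 1 else 0) * ∏ q ∈ S, if (z q.1).1 (z q.2).2 = q.1 then 1 else 0) *
      ((if (z i).1 (z j).2 = i then 1 else 0) - 1 / k) with hF
  have h1 : partialCount k m W (insert (i, j) S) - partialCount k m W S / k = ∑ z, F z := by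
    rw [partialCount, partialCount, Finset.sum_div, ← Finset.sum_sub_distrib]
    refine Finset.sum_congr rfl fun z _ => ?_
    rw [Finset.prod_insert hS, hF]
    ring
  have h01 : ∀ (P : Prop) [Decidable P], |(if P then 1 else 0 : ℝ)| ≤ 1 := by
    intro P _; split_ifs <;> simp
  have hprod : ∀ {ι : Type} (s : Finset ι) (f : ι → ℝ), (∀ l, |f l| ≤ 1) → |∏ l ∈ s, f l| ≤ 1 := by
    intro ι s f hf
    rw [Finset.abs_prod]
    exact Finset.prod_le_one (fun l _ => abs_nonneg _) fun l _ => hf l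
  have hmul : ∀ a b : ℝ, |a| ≤ 1 → |b| ≤ 1 → |a * b| ≤ 1 := fun a b ha hb => by
    rw [abs_mul]; exact mul_le_one₀ ha (abs_nonneg b) hb
  have h2 : ∀ z, |∑ g, ∑ x, F (replaceAt i j z g x)| ≤ (k : ℝ) ^ m * √m := by
    intro z
    -- the conditions that involve the function of the `i`-th vertex, and the remaining ones
    set a : (Fin m → Fin k) → ℝ := fun g => (if (g, (z i).2) ∈ W then 1 else 0) *
      ∏ q ∈ S.filter fun q => q.1 = i, if g (z q.2).2 = q.1 then 1 else 0 with ha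
    set b : Fin m → ℝ := fun x =>
      (∏ l ∈ Finset.univ.erase i, if ((z l).1, if l = j then x else (z l).2) ∈ W then 1 else 0) *
      ∏ q ∈ S.filter fun q => ¬ q.1 = i,
        if (z q.1).1 (if q.2 = j then x else (z q.2).2) = q.1 then 1 else 0 with hb
    have hab : ∀ g x, F (replaceAt i j z g x) =
        a g * b x * ((if g x = i then 1 else 0 : ℝ) - 1 / k) := by
      intro g x
      rw [hF, ha, hb]
      simp only
      rw [← Finset.mul_prod_erase _ _ (Finset.mem_univ i),
        ← Finset.prod_filter_mul_prod_filter_not S fun q => q.1 = i]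
      have e1 : ∏ l ∈ Finset.univ.erase i, (if replaceAt i j z g x l ∈ W then 1 else 0 : ℝ) =
          ∏ l ∈ Finset.univ.erase i,
            if ((z l).1, if l = j then x else (z l).2) ∈ W then 1 else 0 := by
        refine Finset.prod_congr rfl fun l hl => ?_
        simp [replaceAt, Finset.ne_of_mem_erase hl]
      have e2 : ∏ q ∈ S.filter (fun q => q.1 = i),
          (if (replaceAt i j z g x q.1).1 (replaceAt i j z g x q.2).2 = q.1 then 1 else 0 : ℝ) =
          ∏ q ∈ S.filter (fun q => q.1 = i), if g (z q.2).2 = q.1 then 1 else 0 := by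
        refine Finset.prod_congr rfl fun q hq => ?_
        obtain ⟨hqS, hq⟩ := Finset.mem_filter.1 hq
        have hne : q.2 ≠ j := by
          rintro rfl
          exact hS (by rw [← hq]; exact hqS)
        simp [replaceAt, hq, hne]
      have e3 : ∏ q ∈ S.filter (fun q => ¬ q.1 = i),
          (if (replaceAt i j z g x q.1).1 (replaceAt i j z g x q.2).2 = q.1 then 1 else 0 : ℝ) =
          ∏ q ∈ S.filter (fun q => ¬ q.1 = i),
            if (z q.1).1 (if q.2 = j then x else (z q.2).2) = q.1 then 1 else 0 := by
        refine Finset.prod_congr rfl fun q hq => ?_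
        simp [replaceAt, (Finset.mem_filter.1 hq).2]
      have e4 : replaceAt i j z g x i = (g, (z i).2) := by simp [replaceAt, hij]
      have e5 : (replaceAt i j z g x j).2 = x := by simp [replaceAt]
      rw [e1, e2, e3, e4, e5]
      ring
    simp only [hab]
    refine abs_sum_mul_eval_le i a b (fun g => ?_) (fun x => ?_)
    · exact hmul _ _ (h01 _) (hprod _ _ fun q => h01 _)
    · exact hmul _ _ (hprod _ _ fun q => h01 _) (hprod _ _ fun q => h01 _)
  have hk : (0 : ℝ) < k := by exact_mod_cast NeZero.pos k
  have hm' : (0 : ℝ) < m := by exact_mod_cast hm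
  have hM : 0 < (k : ℝ) ^ m * m := by positivity
  have h3 : (k : ℝ) ^ m * m * |∑ z, F z| ≤ (k : ℝ) ^ m * m * (((k : ℝ) ^ m * m) ^ k / √m) := by
    calc (k : ℝ) ^ m * m * |∑ z, F z| = |∑ z, ∑ g, ∑ x, F (replaceAt i j z g x)| := by
          rw [sum_replaceAt, abs_mul, abs_of_pos hM]
      _ ≤ ∑ z : Fin k → (Fin m → Fin k) × Fin m, (k : ℝ) ^ m * √m :=
          (Finset.abs_sum_le_sum_abs _ _).trans (Finset.sum_le_sum fun z _ => h2 z)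
      _ = ((k : ℝ) ^ m * m) ^ k * ((k : ℝ) ^ m * √m) := by simp
      _ = _ := by
          have h4 : √(m : ℝ) * √m = m := Real.mul_self_sqrt hm'.le
          have h5 : 0 < √(m : ℝ) := Real.sqrt_pos.2 hm'
          field_simp
          rw [sq, h4]
  rw [h1]
  exact le_of_mul_le_mul_left h3 hM

lemma abs_partialCount_sub_le [NeZero k] (W : Finset ((Fin m → Fin k) × Fin m))
    (S : Finset (Fin k × Fin k)) (hS : ∀ q ∈ S, q.1 ≠ q.2) :
    |partialCount k m W S - (W.card : ℝ) ^ k * (1 / k) ^ S.card| ≤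
      S.card * (((k : ℝ) ^ m * m) ^ k / √m) := by
  classical
  have hk : (1 : ℝ) ≤ k := by exact_mod_cast NeZero.pos k
  induction S using Finset.induction_on with
  | empty =>
    have h1 : partialCount k m W ∅ = (W.card : ℝ) ^ k := by
      have h2 := Fintype.prod_sum fun (_ : Fin k) (u : (Fin m → Fin k) × Fin m) =>
        (if u ∈ W then 1 else 0 : ℝ)
      simp only [Finset.sum_boole, Finset.filter_univ_mem, Finset.prod_const, Finset.card_univ,
        Fintype.card_fin] at h2
      rw [h2, partialCount]
      simp
    simp [h1]
  | insert q S hq ih =>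
    have ih := ih fun q' hq' => hS q' (Finset.mem_insert_of_mem hq')
    have h1 := abs_partialCount_insert_sub_le W (hS q (Finset.mem_insert_self _ _)) hq
    rw [Finset.card_insert_of_notMem hq]
    set E := ((k : ℝ) ^ m * m) ^ k / √m with hE
    have h2 : partialCount k m W (insert q S) - (W.card : ℝ) ^ k * (1 / k) ^ (S.card + 1) =
        (partialCount k m W (insert q S) - partialCount k m W S / k) +
          (partialCount k m W S - (W.card : ℝ) ^ k * (1 / k) ^ S.card) / k := by
      rw [pow_succ]; ring
    have h3 : |(partialCount k m W S - (W.card : ℝ) ^ k * (1 / k) ^ S.card) / k| ≤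
        S.card * E := by
      rw [abs_div, abs_of_pos (by linarith : (0 : ℝ) < k)]
      exact (div_le_self (abs_nonneg _) hk).trans ih
    rw [h2]
    push_cast
    refine (abs_add_le _ _).trans ?_
    have h4 : |partialCount k m W (insert q S) - partialCount k m W S / k| ≤ E := h1
    linarith

lemma partialCount_offDiag (W : Finset ((Fin m → Fin k) × Fin m)) :
    partialCount k m W Finset.univ.offDiag = tupleCount (evalLabel k m) W := by
  classical
  rw [partialCount, tupleCount_eq, Finset.card_eq_sum_ones, Finset.sum_filter]
  push_cast
  refine Finset.sum_congr rfl fun z _ => ?_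
  rw [Finset.prod_ite_zero, Finset.prod_ite_zero]
  simp only [Finset.prod_const_one, mul_ite, mul_one, mul_zero]
  by_cases h1 : ∀ i, z i ∈ W
  · by_cases h2 : IsConsistent (evalLabel k m) z
    · rw [if_pos, if_pos (by simpa using h1), if_pos ⟨h2, h1⟩]
      rintro ⟨i, j⟩ hq
      exact h2 i j (Finset.mem_offDiag.1 hq).2.2
    · rw [if_neg, if_neg fun h => h2 h.1]
      intro h
      exact h2 fun i j hij => h (i, j) (by simpa using hij)
  · have h3 : ¬ ∀ i ∈ Finset.univ, z i ∈ W := by simpa using h1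
    rw [if_neg (fun h : IsConsistent (evalLabel k m) z ∧ _ => h1 h.2), if_neg h3, ite_self]

lemma abs_tupleCount_evalLabel_sub_le [NeZero k] (W : Finset ((Fin m → Fin k) × Fin m)) :
    |tupleCount (evalLabel k m) W - (W.card : ℝ) ^ k * (1 / k) ^ (k * k - k)| ≤
      (k : ℝ) ^ 2 * (((k : ℝ) ^ m * m) ^ k / √m) := by
  have h1 := abs_partialCount_sub_le W Finset.univ.offDiag fun q hq => (Finset.mem_offDiag.1 hq).2.2
  rw [partialCount_offDiag, Finset.offDiag_card, Finset.card_univ, Fintype.card_fin] at h1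
  refine h1.trans ?_
  gcongr
  rw [sq]
  exact_mod_cast Nat.sub_le _ _

end Quasirandom

/-! ### The sequence -/

section Sequence

variable {k : ℕ}

lemma tendsto_pow_div_choose (k : ℕ) :
    Tendsto (fun n : ℕ => (n : ℝ) ^ k / (n.choose k : ℝ)) atTop (𝓝 (k.factorial : ℝ)) := by
  have hf : (k.factorial : ℝ) ≠ 0 := Nat.cast_ne_zero.2 k.factorial_ne_zero
  have h1 : ∀ᶠ n : ℕ in atTop, ((n : ℝ) ^ k / k.factorial : ℝ) ≠ 0 := by
    filter_upwards [eventually_gt_atTop 0] with n hn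
    have : (n : ℝ) ≠ 0 := Nat.cast_ne_zero.2 hn.ne'
    positivity
  have h2 := (Asymptotics.isEquivalent_iff_tendsto_one h1).1 (isEquivalent_choose k)
  have h3 := (h2.inv₀ one_ne_zero).const_mul (k.factorial : ℝ)
  rw [inv_one, mul_one] at h3
  refine h3.congr fun n => ?_
  simp only [Pi.div_apply, inv_div]
  field_simp

lemma card_evalVertices (k n : ℕ) :
    Fintype.card ((Fin n → Fin k) × Fin n) = k ^ n * n := by
  simp

lemma tendsto_card_evalVertices [NeZero k] :
    Tendsto (fun n => Fintype.card ((Fin n → Fin k) × Fin n)) atTop atTop := by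
  refine tendsto_atTop_mono (fun n => ?_) tendsto_id
  rw [card_evalVertices]
  exact Nat.le_mul_of_pos_left _ (pow_pos (NeZero.pos k) n)

lemma density_induce_evalGraph (hk : 3 ≤ k) {n : ℕ} (W : Finset ((Fin n → Fin k) × Fin n)) :
    ((labelGraph (evalLabel k n)).induce W).density =
      (tupleCount (evalLabel k n) W : ℝ) / (W.card.choose k : ℝ) := by
  rw [KGraph.density_induce, card_edges_induce_labelGraph hk]

/-- The limiting density of the universal labelling graphs: each of the `k!` orders of a `k`-set is
consistent with probability `k ^ (- (k * k - k))`. -/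
noncomputable def evalDensity (k : ℕ) : ℝ := (1 / k) ^ (k * k - k) * k.factorial

lemma exists_abs_density_evalGraph_sub_le [NeZero k] (hk : 3 ≤ k) {ε δ : ℝ} (hε : 0 < ε)
    (hδ : 0 < δ) : ∃ n₀ : ℕ, ∀ n, n₀ < n → ∀ W : Finset ((Fin n → Fin k) × Fin n),
      ε * (Fintype.card ((Fin n → Fin k) × Fin n) : ℝ) ≤ (W.card : ℝ) →
      |((labelGraph (evalLabel k n)).induce W).density - evalDensity k| ≤ δ := by
  obtain ⟨η, hη, hmul⟩ := Metric.continuousAt_iff.1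
    (continuous_mul.continuousAt (x := (((1 / k) ^ (k * k - k), k.factorial) : ℝ × ℝ))) δ hδ
  obtain ⟨w₀, hw₀⟩ := Filter.eventually_atTop.1
    (Metric.tendsto_nhds.1 (tendsto_pow_div_choose k) η hη)
  have h1 : Tendsto (fun n : ℕ => (k : ℝ) ^ 2 * (1 / ε) ^ k / √(n : ℝ)) atTop (𝓝 0) :=
    tendsto_const_nhds.div_atTop (Real.tendsto_sqrt_atTop.comp tendsto_natCast_atTop_atTop)
  have h2 : Tendsto (fun n => ε * (Fintype.card ((Fin n → Fin k) × Fin n) : ℝ)) atTop atTop :=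
    (tendsto_natCast_atTop_atTop.comp tendsto_card_evalVertices).const_mul_atTop hε
  obtain ⟨n₀, hn₀⟩ := Filter.eventually_atTop.1 ((h1.eventually_lt_const hη).and
    (h2.eventually_ge_atTop ((w₀ : ℝ) + 1)))
  refine ⟨n₀, fun n hn W hW => ?_⟩
  obtain ⟨h3, h4⟩ := hn₀ n hn.le
  have hw1 : (w₀ : ℝ) + 1 ≤ W.card := h4.trans hW
  have hw2 : w₀ ≤ W.card := by exact_mod_cast (by linarith : (w₀ : ℝ) ≤ W.card)
  have hw0 : (0 : ℝ) < W.card := by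
    have : (0 : ℝ) ≤ w₀ := Nat.cast_nonneg w₀
    linarith
  have h5 := hw₀ _ hw2
  have hwk : 0 < (W.card : ℝ) ^ k := by positivity
  have h6 : |(tupleCount (evalLabel k n) W : ℝ) / (W.card : ℝ) ^ k - (1 / k) ^ (k * k - k)| <
      η := by
    have h7 := abs_tupleCount_evalLabel_sub_le W
    have h8 : (tupleCount (evalLabel k n) W : ℝ) / (W.card : ℝ) ^ k - (1 / k) ^ (k * k - k) =
        (tupleCount (evalLabel k n) W - (W.card : ℝ) ^ k * (1 / k) ^ (k * k - k)) /
          (W.card : ℝ) ^ k := by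
      field_simp
    have h9 : ((k : ℝ) ^ n * n) ^ k ≤ (1 / ε) ^ k * (W.card : ℝ) ^ k := by
      rw [← mul_pow]
      refine pow_le_pow_left₀ (by positivity) ?_ k
      rw [card_evalVertices] at hW
      push_cast at hW
      rw [one_div_mul_eq_div, le_div_iff₀ hε]
      linarith
    rw [h8, abs_div, abs_of_pos hwk, div_lt_iff₀ hwk]
    calc _ ≤ (k : ℝ) ^ 2 * (((k : ℝ) ^ n * n) ^ k / √n) := h7
      _ ≤ (k : ℝ) ^ 2 * (((1 / ε) ^ k * (W.card : ℝ) ^ k) / √n) := by gcongr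
      _ = (k : ℝ) ^ 2 * (1 / ε) ^ k / √(n : ℝ) * (W.card : ℝ) ^ k := by ring
      _ < η * (W.card : ℝ) ^ k := by gcongr
  have h10 := hmul (x := ((tupleCount (evalLabel k n) W : ℝ) / (W.card : ℝ) ^ k,
    (W.card : ℝ) ^ k / (W.card.choose k : ℝ))) (by
      rw [Prod.dist_eq, max_lt_iff]
      exact ⟨h6, h5⟩)
  rw [Real.dist_eq] at h10
  rw [density_induce_evalGraph hk, evalDensity]
  refine le_trans (le_of_eq ?_) h10.le
  congr 2
  rw [div_mul_div_cancel₀ hwk.ne']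

lemma density_eq_density_induce_univ {V : Type} [Fintype V] (H : KGraph k V) :
    H.density = (H.induce Finset.univ).density := by
  classical
  rw [KGraph.density_induce, KGraph.card_edges_induce, KGraph.density, Finset.card_univ]
  simp

/-- The sequence of the hypergraphs of the universal labellings. The `n`-th one has
`k ^ n * n` vertices. -/
noncomputable def evalSequence (k : ℕ) [NeZero k] (hk : 3 ≤ k) : KGraphSequence k where
  V n := (Fin n → Fin k) × Fin n
  graph n := labelGraph (evalLabel k n)
  card_tendsto := tendsto_card_evalVertices
  density_converges := by
    refine ⟨evalDensity k, Metric.tendsto_atTop.2 fun δ hδ => ?_⟩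
    obtain ⟨n₀, hn₀⟩ := exists_abs_density_evalGraph_sub_le hk one_pos (half_pos hδ)
    refine ⟨n₀ + 1, fun n hn => ?_⟩
    rw [density_eq_density_induce_univ, Real.dist_eq]
    refine (hn₀ n hn Finset.univ ?_).trans_lt (half_lt_self hδ)
    rw [Finset.card_univ, one_mul]

lemma evalDensity_pos [NeZero k] : 0 < evalDensity k := by
  have : (0 : ℝ) < k := by exact_mod_cast NeZero.pos k
  have := k.factorial_pos
  unfold evalDensity
  positivity

lemma isQuasirandom_evalSequence [NeZero k] (hk : 3 ≤ k) :
    (evalSequence k hk).IsQuasirandom (evalDensity k) := by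
  intro ε hε
  obtain ⟨n₀, hn₀⟩ := exists_abs_density_evalGraph_sub_le hk hε
    (mul_pos (evalDensity_pos (k := k)) hε)
  have hIcc : ∀ {x : ℝ}, |x - evalDensity k| ≤ evalDensity k * ε →
      x ∈ Set.Icc (evalDensity k * (1 - ε)) (evalDensity k * (1 + ε)) := fun hx => by
    have h1 := abs_le.1 hx
    constructor <;> linarith [h1.1, h1.2]
  exact ⟨n₀, fun n hn W hW => hIcc (hn₀ n hn W hW)⟩

/-- For each `s`, the densities of the subgraphs induced by `s`-sets take only finitely many values,
so that their maximum exists. -/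
lemma KGraphSequence.exists_isGreatest_density (H : KGraphSequence k) (s : ℕ) :
    ∃ m, IsGreatest {x : ℝ | ∃ (n : ℕ) (S : Finset (H.V n)), S.card = s ∧
      x = ((H.graph n).induce S).density} m := by
  classical
  set A := {x : ℝ | ∃ (n : ℕ) (S : Finset (H.V n)), S.card = s ∧
      x = ((H.graph n).induce S).density} with hA
  have hne : A.Nonempty := by
    obtain ⟨n, hn⟩ := (H.card_tendsto.eventually_ge_atTop s).exists
    obtain ⟨S, -, hS⟩ := Finset.exists_subset_card_eq
      (s := (Finset.univ : Finset (H.V n))) (n := s) (by rw [Finset.card_univ]; exact hn)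
    exact ⟨_, n, S, hS, rfl⟩
  have hfin : A.Finite := by
    refine ((Finset.range (2 ^ s + 1)).image fun e : ℕ =>
      (e : ℝ) / (s.choose k : ℝ)).finite_toSet.subset ?_
    rintro x ⟨n, S, hS, rfl⟩
    rw [KGraph.density_induce, hS]
    refine Finset.mem_coe.2 (Finset.mem_image.2 ⟨_, ?_, rfl⟩)
    have h1 := Finset.card_le_univ ((H.graph n).induce S).edges
    rw [Fintype.card_finset, Fintype.card_coe, hS] at h1
    rw [Finset.mem_range]
    omega
  obtain ⟨m, hm, hmax⟩ := Set.exists_max_image A id hfin hne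
  exact ⟨m, hm, hmax⟩

/-- The hypergraph of the universal labelling contains an iterated blow-up of an edge, and therefore
`s`-sets of at least its density. -/
lemma exists_le_density_evalGraph [NeZero k] (hk : 4 ≤ k) {s : ℕ} (hs : k ≤ s) :
    ∃ (n : ℕ) (S : Finset ((Fin n → Fin k) × Fin n)), S.card = s ∧
      (k.factorial : ℝ) / ((k : ℝ) ^ k - k) * (1 - ((k : ℝ) / (k : ℝ) ^ k) ^ s) ≤
        ((labelGraph (evalLabel k n)).induce S).density := by
  have hk4 : (4 : ℝ) ≤ k := by exact_mod_cast hk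
  have hden : 0 < (k : ℝ) ^ k - k := sub_pos.2 (lt_self_pow₀ (by linarith) (by omega))
  obtain ⟨T, hT, hle⟩ := exists_le_tupleCount_evalLabel (wordLabel k s)
  have hcard : Fintype.card (Fin s → Fin k) = k ^ s := by simp
  have hsT : s ≤ T.card := by
    rw [hT, hcard]
    exact (Nat.lt_pow_self (by omega)).le
  obtain ⟨S, -, hS, hdens⟩ :=
    (labelGraph (evalLabel k (Fintype.card (Fin s → Fin k)))).exists_subset_density_le T hs hsT
  refine ⟨_, S, hS, le_trans ?_ hdens⟩
  have hTc : T.card = k ^ s := hT.trans hcard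
  rw [density_induce_evalGraph (by omega), hTc]
  have h1 := le_tupleCount_wordLabel (by omega : 2 ≤ k) s
  have h2 : (tupleCount (wordLabel k s) Finset.univ : ℝ) ≤
      tupleCount (evalLabel k (Fintype.card (Fin s → Fin k))) T := by exact_mod_cast hle
  have h3 : (0 : ℝ) < ((k ^ s).choose k : ℕ) := by
    exact_mod_cast Nat.choose_pos (by rw [← hTc]; omega)
  have h4 : (((k ^ s).choose k : ℕ) : ℝ) ≤ ((k : ℝ) ^ s) ^ k / k.factorial := by
    have := Nat.choose_le_pow_div (α := ℝ) k (k ^ s)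
    push_cast at this
    exact this
  have hf : (0 : ℝ) < k.factorial := by exact_mod_cast k.factorial_pos
  have hks : (0 : ℝ) < ((k : ℝ) ^ s) ^ k := by positivity
  have hks' : ((k : ℝ) / (k : ℝ) ^ k) ^ s = (k : ℝ) ^ s / ((k : ℝ) ^ s) ^ k := by
    rw [div_pow, ← pow_mul, ← pow_mul, mul_comm k s]
  have h5 : 0 ≤ 1 - ((k : ℝ) / (k : ℝ) ^ k) ^ s := by
    rw [sub_nonneg]
    refine pow_le_one₀ (by positivity) ?_
    rw [div_le_one (by positivity)]
    linarith
  rw [le_div_iff₀ h3]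
  calc (k.factorial : ℝ) / ((k : ℝ) ^ k - k) * (1 - ((k : ℝ) / (k : ℝ) ^ k) ^ s) *
        ((k ^ s).choose k : ℕ)
      ≤ (k.factorial : ℝ) / ((k : ℝ) ^ k - k) * (1 - ((k : ℝ) / (k : ℝ) ^ k) ^ s) *
        (((k : ℝ) ^ s) ^ k / k.factorial) := by gcongr
    _ = (((k : ℝ) ^ s) ^ k - (k : ℝ) ^ s) / ((k : ℝ) ^ k - k) := by
        rw [hks']
        field_simp
    _ ≤ tupleCount (wordLabel k s) Finset.univ := by
        rw [div_le_iff₀ hden]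
        linarith
    _ ≤ _ := h2

lemma density_induce_evalGraph_le [NeZero k] (hk : 4 ≤ k) {n : ℕ}
    (S : Finset ((Fin n → Fin k) × Fin n)) :
    ((labelGraph (evalLabel k n)).induce S).density ≤
      1 / ((k : ℝ) ^ k - k) * ((S.card : ℝ) ^ k / (S.card.choose k : ℝ)) := by
  rw [density_induce_evalGraph (by omega), mul_div_assoc']
  exact div_le_div_of_nonneg_right (tupleCount_le hk _ _) (Nat.cast_nonneg _)

lemma hasUpperDensity_evalSequence [NeZero k] (hk : 4 ≤ k) :
    (evalSequence k (by omega)).HasUpperDensity ((k.factorial : ℝ) / ((k : ℝ) ^ k - k)) := by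
  have hk4 : (4 : ℝ) ≤ k := by exact_mod_cast hk
  have hkk : (k : ℝ) < (k : ℝ) ^ k := lt_self_pow₀ (by linarith) (by omega)
  choose m hm using (evalSequence k (by omega : 3 ≤ k)).exists_isGreatest_density
  refine ⟨m, hm, ?_⟩
  have hlow : Tendsto (fun s : ℕ => (k.factorial : ℝ) / ((k : ℝ) ^ k - k) *
      (1 - ((k : ℝ) / (k : ℝ) ^ k) ^ s)) atTop (𝓝 ((k.factorial : ℝ) / ((k : ℝ) ^ k - k))) := by
    have h1 := tendsto_pow_atTop_nhds_zero_of_lt_one (r := (k : ℝ) / (k : ℝ) ^ k) (by positivity)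
      (by rw [div_lt_one (by positivity)]; exact hkk)
    simpa using (h1.const_sub 1).const_mul ((k.factorial : ℝ) / ((k : ℝ) ^ k - k))
  have hup : Tendsto (fun s : ℕ => 1 / ((k : ℝ) ^ k - k) * ((s : ℝ) ^ k / (s.choose k : ℝ))) atTop
      (𝓝 ((k.factorial : ℝ) / ((k : ℝ) ^ k - k))) := by
    have h1 := (tendsto_pow_div_choose k).const_mul (1 / ((k : ℝ) ^ k - k))
    rwa [one_div_mul_eq_div] at h1
  refine tendsto_of_tendsto_of_tendsto_of_le_of_le' hlow hup ?_ ?_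
  · filter_upwards [eventually_ge_atTop k] with s hs
    obtain ⟨n, S, hS, hle⟩ := exists_le_density_evalGraph hk hs
    exact hle.trans ((hm s).2 ⟨n, S, hS, rfl⟩)
  · refine Eventually.of_forall fun s => ?_
    obtain ⟨n, S, hS, hx⟩ := (hm s).1
    rw [hx, ← hS]
    exact density_induce_evalGraph_le hk S

end Sequence

theorem theorem2 (k : ℕ) (hk : 4 ≤ k) :
    ∃ ρ : ℝ, 0 < ρ ∧ ∃ H : KGraphSequence k,
      H.IsQuasirandom ρ ∧
      H.HasUpperDensity ((Nat.factorial k : ℝ) / ((k : ℝ) ^ k - (k : ℝ))) := by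
  have : NeZero k := ⟨by omega⟩
  exact ⟨evalDensity k, evalDensity_pos, evalSequence k (by omega),
    isQuasirandom_evalSequence (by omega), hasUpperDensity_evalSequence hk⟩
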